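/- Conventions. For an integer matrix $B=(b_{ij})_{i,j\in I}$ and $k\in I$, the mutation $\mu_k(B)=(b'_{ij})$ is $b'_{ij}=-b_{ij}$ if $i=k$ or $j=k$, and $b'_{ij}=b_{ij}+b_{ik}[b_{kj}]_+ +[-b_{ik}]_+b_{kj}$ otherwise, where $[x]_+=\max(x,0)$. The Cartan counterpart $A(B)=(a_{ij})$ is $a_{ii}=2$, $a_{ij}=-|b_{ij}|$ for $i\neq j$. A skew-symmetrizable integer matrix $B$ is of cluster type $Z$ if some finite sequence of mutations takes it to a matrix $B'$ such that $A(B')$ is, up to simultaneous relabelling of rows and columns, the Cartan matrix of type $Z$. Cartan matrices are normalized by $a_{ij}=2(\alpha_i,\alpha_j)/(\alpha_i,\alpha_i)$; thus the Cartan matrix of type $B_n$ has last row $(0,\dots,0,-2,2)$, and its last simple root is short. The Dynkin diagram $X(B)$ has vertex set $I$ and $a_{ij}a_{ji}$ edges between $i\ne j$; the edges between $i$ and $j$ carry an inequality sign $i>j$ when $0<|a_{ij}|<|a_{ji}|$, that is, when $\alpha_i$ is longer than $\alpha_j$. Let $\mathcal X(Z)$ be the set of all diagrams $X(B)$ with $B$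 of cluster type $Z$. By a type-$A$ piece with attaching vertex $c$ we mean a diagram in $\mathcal X(A_m)$ for some $m\geq 1$ together with a vertex $c$ of it that has at most two neighbours in it, these two being adjacent if there are two. Proposition. Let $n\ge 2$. A diagram $X$ with $n$ vertices belongs to $\mathcal X(B_n)$ if and only if it has one of the following two shapes. (1) $X$ consists of a type-$A$ piece $X^{(1)}$ with attaching vertex $c$ and one further vertex $a$, joined to $c$ by a double edge with inequality sign $c>a$ and joined to no other vertex. (2) $X$ consists of two disjoint type-$A$ pieces $X^{(1)}$, $X^{(2)}$ with attaching vertices $c$, $d$, and one further vertex $a$; the vertices $c$ and $d$ are joined by a single edge; $a$ is joined to $c$ and to $d$ by double edges with inequality signs $c>a$ and $d>a$; and there are no other edges between $X^{(1)}$ and $X^{(2)}$ or at $a$. -/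

import Mathlib

open scoped Matrix

namespace ClusterDynkin

/-- An integer matrix `B` is skew-symmetrizable if `D * B` is skew-symmetric for some diagonal
matrix `D` with positive integer diagonal entries. -/
def IsSkewSymmetrizable {I : Type*} (B : Matrix I I ℤ) : Prop :=
  ∃ d : I → ℤ, (∀ i, 0 < d i) ∧ ∀ i j, d i * B i j = -(d j * B j i)

/-- Matrix mutation `μ_k`; here `max x 0` is the positive part of `x`. -/
def mutate {I : Type*} [DecidableEq I] (k : I) (B : Matrix I I ℤ) : Matrix I I ℤ :=
  Matrix.of fun i j =>
    if i = k ∨ j = k then -B i j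
    else B i j + B i k * max (B k j) 0 + max (-B i k) 0 * B k j

/-- `B'` is obtained from `B` by a finite (possibly empty) sequence of mutations. Mutations of
skew-symmetrizable matrices are involutions, so on these the relation is symmetric. -/
def MutationEquiv {I : Type*} [DecidableEq I] : Matrix I I ℤ → Matrix I I ℤ → Prop :=
  Relation.ReflTransGen fun B B' => ∃ k, B' = mutate k B

/-- The Cartan counterpart `A(B)`. -/
def cartanCounterpart {I : Type*} [DecidableEq I] (B : Matrix I I ℤ) : Matrix I I ℤ :=
  Matrix.of fun i j => if i = j then 2 else -|B i j|

/-- `B` is skew-symmetrizable and mutation equivalent to a matrix whose Cartan counterpart is,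
up to a simultaneous relabelling of rows and columns, the Cartan matrix `C`. -/
def IsOfClusterType {I J : Type*} [DecidableEq I] (C : Matrix J J ℤ) (B : Matrix I I ℤ) : Prop :=
  IsSkewSymmetrizable B ∧
    ∃ B' : Matrix I I ℤ, MutationEquiv B B' ∧ ∃ e : I ≃ J, cartanCounterpart B' = C.submatrix e e

/-- The Cartan matrix of type `A_n`. -/
abbrev cartanA (n : ℕ) : Matrix (Fin n) (Fin n) ℤ := CartanMatrix.A n

/-- The Cartan matrix of type `B_n` in the convention `a i j = 2 (α_i, α_j) / (α_i, α_i)` of Kac: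
the last simple root is the short one, and the last row is `(0, …, 0, -2, 2)`. Mathlib's
`CartanMatrix.B n` follows the transposed convention of Bourbaki. -/
abbrev cartanB (n : ℕ) : Matrix (Fin n) (Fin n) ℤ := (CartanMatrix.B n)ᵀ

/-- A Dynkin diagram on the vertex set `V`: a loopless graph with multiple edges, in which a
multiple edge may carry an inequality sign. `arrow i j` says that the edge between `i` and `j`
carries the sign that is read as "`i` greater than `j`". -/
@[ext]
structure DynkinDiagram (V : Type*) where
  mult : V → V → ℕ
  arrow : V → V → Prop
  mult_self : ∀ i, mult i i = 0
  mult_symm : ∀ i j, mult i j = mult j i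
  arrow_asymm : ∀ i j, arrow i j → ¬ arrow j i
  two_le_mult_of_arrow : ∀ i j, arrow i j → 2 ≤ mult i j

namespace DynkinDiagram

variable {V : Type*}

/-- Two vertices are adjacent if there is at least one edge between them. -/
def Adj (X : DynkinDiagram V) (i j : V) : Prop := X.mult i j ≠ 0

/-- There is exactly one edge between `i` and `j` (and so it carries no inequality sign). -/
def SingleEdge (X : DynkinDiagram V) (i j : V) : Prop := X.mult i j = 1

/-- There are exactly two edges between `i` and `j`, with the inequality sign "`i` greater
than `j`". -/
def DoubleEdge (X : DynkinDiagram V) (i j : V) : Prop := X.mult i j = 2 ∧ X.arrow i j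

/-- The full sub-diagram on a set of vertices. -/
def restrict (X : DynkinDiagram V) (S : Set V) : DynkinDiagram S where
  mult i j := X.mult i j
  arrow i j := X.arrow i j
  mult_self i := X.mult_self i
  mult_symm i j := X.mult_symm i j
  arrow_asymm i j := X.arrow_asymm i j
  two_le_mult_of_arrow i j := X.two_le_mult_of_arrow i j

end DynkinDiagram

/-- The Dynkin diagram of a matrix `A`: there are `a i j * a j i` edges between `i ≠ j`, and the
inequality sign says that the simple root `α_i` is longer than `α_j` when `|a i j| < |a j i|`
(recall `a i j / a j i = (α_j, α_j) / (α_i, α_i)`). -/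
def diagramOfCartan {V : Type*} [DecidableEq V] (A : Matrix V V ℤ) : DynkinDiagram V where
  mult i j := if i = j then 0 else (A i j).natAbs * (A j i).natAbs
  arrow i j := A i j ≠ 0 ∧ |A i j| < |A j i|
  mult_self i := by simp
  mult_symm i j := by simp only [eq_comm, mul_comm]
  arrow_asymm i j h h' := absurd h.2 (not_lt.2 h'.2.le)
  two_le_mult_of_arrow i j h := by
    obtain ⟨h0, h1⟩ := h
    have hij : i ≠ j := by
      rintro rfl
      exact lt_irrefl _ h1
    rw [if_neg hij]
    have h2 : 1 ≤ (A i j).natAbs := Int.natAbs_pos.2 h0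
    have h3 : 2 ≤ (A j i).natAbs := by
      rw [Int.abs_eq_natAbs, Int.abs_eq_natAbs] at h1
      omega
    nlinarith

/-- The Dynkin diagram `X(B)`, which presents the Cartan counterpart of `B`. -/
def diagram {V : Type*} [DecidableEq V] (B : Matrix V V ℤ) : DynkinDiagram V :=
  diagramOfCartan (cartanCounterpart B)

/-- The diagrams `X(B)`, on the vertex set `V`, of all matrices `B` of the cluster type given by
the Cartan matrix `C`. -/
def clusterDiagrams {J : Type*} (C : Matrix J J ℤ) (V : Type*) [DecidableEq V] :
    Set (DynkinDiagram V) :=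
  {X | ∃ B : Matrix V V ℤ, IsOfClusterType C B ∧ diagram B = X}

/-- The full sub-diagram of `X` on `S` is a diagram of cluster type `A_m` for some `m`, and `c` is
one of its vertices at which it may be attached to the rest of a larger diagram: `c` has at most
two neighbours in `S`, and if it has two, then these two are adjacent. -/
def IsTypeAPieceAt {V : Type*} [DecidableEq V] (X : DynkinDiagram V) (S : Set V) (c : V) : Prop :=
  (∃ m : ℕ, X.restrict S ∈ clusterDiagrams (cartanA m) S) ∧ c ∈ S ∧
    {v ∈ S | X.Adj c v}.encard ≤ 2 ∧
    ∀ u ∈ S, ∀ v ∈ S, X.Adj c u → X.Adj c v → u ≠ v → X.Adj u v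

/-- First shape: a vertex `a` (short root), a type `A` piece on all the other vertices, and a
double edge from a vertex `c` of that piece to `a`; no other edges at `a`. -/
def HasFirstShape {V : Type*} [DecidableEq V] (X : DynkinDiagram V) : Prop :=
  ∃ a c : V, IsTypeAPieceAt X {a}ᶜ c ∧ X.DoubleEdge c a ∧ ∀ v, X.Adj v a → v = c

/-- Second shape: a vertex `a` (short root), two disjoint type `A` pieces on `S` and `T` that
together cover all the other vertices, and a triangle on `a`, `c ∈ S`, `d ∈ T` whose sides
`c a` and `d a` are double edges and whose side `c d` is a single edge; no other edges at `a` or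
between `S` and `T`. -/
def HasSecondShape {V : Type*} [DecidableEq V] (X : DynkinDiagram V) : Prop :=
  ∃ (a c d : V) (S T : Set V),
    S ∪ T = {a}ᶜ ∧ Disjoint S T ∧ IsTypeAPieceAt X S c ∧ IsTypeAPieceAt X T d ∧
    X.DoubleEdge c a ∧ X.DoubleEdge d a ∧ X.SingleEdge c d ∧
    (∀ v, X.Adj v a → v = c ∨ v = d) ∧
    ∀ u ∈ S, ∀ v ∈ T, X.Adj u v → u = c ∧ v = d

end ClusterDynkin

/-!
Exchange matrices of types `A` and `B` are encoded by binary trees whose nodes are the vertices: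
a node `v` with children `l` and `r` contributes an oriented triangle `v → l → r → v`, which
degenerates to an arrow, or to nothing, if children are missing (`treeMatrix`). Geometrically, such
a tree is a triangulation of a polygon read from one of its sides: the root is that side, the other
nodes are the diagonals, and a node with its two children is a triangle.

For type `B` the root `a` is the short root and its row is doubled. This corresponds to a centrally
symmetric triangulation cut along its diameter `a`. Mutation at `a` exchanges the two subtrees
(`mutate_rowScale_add_triangle`), and mutation at any other vertex is a flip of the tree
(`Flip.mutate_treeMatrix`); so matrices of this form are closed under mutation. They include the
exchange matrices of the path `B_n` with every orientation, and flips lead from any tree to a path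
(`exists_flips_rightComb`); hence they are exactly the matrices of type `B_n`, as is recorded
on the level of diagrams in `mem_clusterDiagrams_cartanB_iff`. The two shapes correspond to the root
having one or two children.

It remains to identify a type `A` piece with an attaching vertex `c` as the diagram of a tree with
root `c`. Matrices of type `A` arise from three trees joined at their roots by an oriented triangle
(`tripleMatrix`). The same matrix can be read from any vertex `c`, which then lies in two
triangles `c → A → B → c` and `c → C → D → c` (`exists_tripleMatrix_eq`), and in this form mutation
at `c` is the rotation of the four trees `A`, `B`, `C`, `D`. A neighbour of `c` in one triangle is
not adjacent to a neighbour in the other, so `c` is an attaching vertex only if one of the triangles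
is empty, and then `c` is the root of a single tree (`exists_treeMatrix_eq_tripleMatrix`). The
converse holds because a tree is flip equivalent to a path with the same root.
-/

namespace ClusterDynkin

open BinaryTree

/-! ### Labelled binary trees and their matrices -/

section Trees

variable {V : Type*}

/-- The label of the root, or `none` for the empty tree. -/
def rootLabel : BinaryTree V → Option V
  | nil => none
  | node v _ _ => some v

/-- The labels of a tree, in preorder. -/
def labels : BinaryTree V → List V
  | nil => []
  | node v l r => v :: (labels l ++ labels r)

@[simp] lemma rootLabel_nil : rootLabel (nil : BinaryTree V) = none := rfl
@[simp] lemma rootLabel_node (v : V) (l r : BinaryTree V) : rootLabel (node v l r) = some v := rfl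
@[simp] lemma labels_nil : labels (nil : BinaryTree V) = [] := rfl
@[simp] lemma labels_node (v : V) (l r : BinaryTree V) :
    labels (node v l r) = v :: (labels l ++ labels r) := rfl

lemma mem_labels_of_rootLabel_eq {t : BinaryTree V} {v : V} (h : rootLabel t = some v) :
    v ∈ labels t := by
  cases t <;> simp_all

variable [DecidableEq V]

/-- The indicator function of an optional vertex; it vanishes for a missing vertex. -/
def indicator (x : Option V) (v : V) : ℤ := if x = some v then 1 else 0

/-- The exchange matrix of the quiver with a single arrow from `x` to `y`; it is zero if one of
the two vertices is missing. -/
def arc (x y : Option V) : Matrix V V ℤ :=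
  Matrix.of fun i j => indicator x i * indicator y j - indicator y i * indicator x j

/-- The exchange matrix of the oriented triangle `x → y → z → x`, where any of the three vertices
may be missing. -/
def triangle (x y z : Option V) : Matrix V V ℤ := arc x y + arc y z + arc z x

/-- The exchange matrix of a labelled binary tree: every node `v` with children `l` and `r`
contributes an oriented triangle `v → l → r → v`. -/
def treeMatrix : BinaryTree V → Matrix V V ℤ
  | nil => 0
  | node v l r => treeMatrix l + treeMatrix r + triangle (some v) (rootLabel l) (rootLabel r)

/-- The exchange matrix obtained from three trees by joining their roots into an oriented
triangle. -/
def tripleMatrix (u l r : BinaryTree V) : Matrix V V ℤ :=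
  treeMatrix u + treeMatrix l + treeMatrix r +
    triangle (rootLabel u) (rootLabel l) (rootLabel r)

@[simp] lemma treeMatrix_nil : treeMatrix (nil : BinaryTree V) = 0 := rfl

lemma treeMatrix_node (v : V) (l r : BinaryTree V) : treeMatrix (node v l r) =
    treeMatrix l + treeMatrix r + triangle (some v) (rootLabel l) (rootLabel r) := rfl

@[simp] lemma indicator_none (v : V) : indicator none v = 0 := by simp [indicator]

@[simp] lemma indicator_self (v : V) : indicator (some v) v = 1 := by simp [indicator]

lemma indicator_some_of_ne {v w : V} (h : v ≠ w) : indicator (some v) w = 0 := by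
  simp [indicator, h]

lemma indicator_nonneg (x : Option V) (v : V) : 0 ≤ indicator x v := by
  unfold indicator; split_ifs <;> simp

lemma indicator_rootLabel_eq_zero {t : BinaryTree V} {v : V} (h : v ∉ labels t) :
    indicator (rootLabel t) v = 0 :=
  if_neg fun h' => h (mem_labels_of_rootLabel_eq h')

lemma triangle_apply (x y z : Option V) (i j : V) : triangle x y z i j =
    (indicator x i * indicator y j - indicator y i * indicator x j) +
    (indicator y i * indicator z j - indicator z i * indicator y j) +
    (indicator z i * indicator x j - indicator x i * indicator z j) := rfl

lemma triangle_rotate (x y z : Option V) : triangle x y z = triangle y z x := by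
  unfold triangle; abel

lemma arc_none_left (x : Option V) : arc none x = 0 := by
  ext i j; simp [arc]

lemma arc_none_right (x : Option V) : arc x none = 0 := by
  ext i j; simp [arc]

lemma triangle_skew (x y z : Option V) (i j : V) : triangle x y z i j = -triangle x y z j i := by
  simp only [triangle_apply]; ring

lemma treeMatrix_skew (t : BinaryTree V) (i j : V) : treeMatrix t i j = -treeMatrix t j i := by
  induction t with
  | nil => simp
  | node v l r hl hr =>
    simp only [treeMatrix_node, Matrix.add_apply]
    rw [hl, hr, triangle_skew]; ring

lemma triangle_eq_zero_left {x y z : Option V} {i : V} (hx : indicator x i = 0)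
    (hy : indicator y i = 0) (hz : indicator z i = 0) (j : V) : triangle x y z i j = 0 := by
  simp [triangle_apply, hx, hy, hz]

lemma treeMatrix_eq_zero_left {t : BinaryTree V} {i : V} (h : i ∉ labels t) (j : V) :
    treeMatrix t i j = 0 := by
  induction t with
  | nil => simp
  | node v l r hl hr =>
    simp only [labels_node, List.mem_cons, List.mem_append, not_or] at h
    simp only [treeMatrix_node, Matrix.add_apply, hl h.2.1, hr h.2.2, zero_add]
    exact triangle_eq_zero_left (indicator_some_of_ne (Ne.symm h.1))
      (indicator_rootLabel_eq_zero h.2.1) (indicator_rootLabel_eq_zero h.2.2) j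

lemma treeMatrix_eq_zero_right {t : BinaryTree V} {j : V} (h : j ∉ labels t) (i : V) :
    treeMatrix t i j = 0 := by
  rw [treeMatrix_skew, treeMatrix_eq_zero_left h, neg_zero]

lemma tripleMatrix_rotate (u l r : BinaryTree V) :
    tripleMatrix u l r = tripleMatrix l r u := by
  unfold tripleMatrix; rw [triangle_rotate]; abel

lemma tripleMatrix_node_nil_nil (v : V) (l r : BinaryTree V) :
    tripleMatrix (node v l r) nil nil = treeMatrix (node v l r) := by
  simp [tripleMatrix, triangle, arc_none_left, arc_none_right]

/-- Reading the quiver from another node: if `c` is a vertex of the tree `l`, then three trees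
joined at their roots can be rewritten as three trees joined at their roots, the first of which
has the root `c`. When the root `p` of `l` is passed, the triangle at `p` inside `l` and the
joining triangle exchange their roles. -/
lemma exists_tripleMatrix_eq_of_mem_middle (c : V) (l : BinaryTree V) :
    ∀ u r : BinaryTree V, c ∈ labels l → ∃ A B C D : BinaryTree V,
      tripleMatrix (node c A B) C D = tripleMatrix u l r ∧
      (labels (node c A B) ++ (labels C ++ labels D)).Perm
        (labels u ++ (labels l ++ labels r)) := by
  induction l with
  | nil => intro u r h; simp at h
  | node p l₁ l₂ h₁ h₂ =>
    intro u r h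
    have key : tripleMatrix (node p r u) l₁ l₂ = tripleMatrix u (node p l₁ l₂) r := by
      simp only [tripleMatrix, treeMatrix_node, rootLabel_node, triangle]; abel
    have hperm : (labels (node p r u) ++ (labels l₁ ++ labels l₂)).Perm
        (labels u ++ (labels (node p l₁ l₂) ++ labels r)) := by
      rw [List.perm_iff_count]; intro x
      simp only [labels_node, List.count_append, List.count_cons]; omega
    simp only [labels_node, List.mem_cons, List.mem_append] at h
    rcases h with rfl | h | h
    · refine ⟨l₁, l₂, r, u, by rw [tripleMatrix_rotate u], ?_⟩
      rw [List.perm_iff_count]; intro x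
      simp only [labels_node, List.count_append, List.count_cons]; omega
    · obtain ⟨A, B, C, D, e, hp⟩ := h₁ (node p r u) l₂ h
      exact ⟨A, B, C, D, e.trans key, hp.trans hperm⟩
    · obtain ⟨A, B, C, D, e, hp⟩ := h₂ l₁ (node p r u) h
      refine ⟨A, B, C, D, e.trans (by rw [← key, ← tripleMatrix_rotate]), ?_⟩
      refine hp.trans (List.Perm.trans ?_ hperm)
      rw [List.perm_iff_count]; intro x
      simp only [labels_node, List.count_append, List.count_cons]; omega

lemma exists_tripleMatrix_eq {c : V} {u l r : BinaryTree V}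
    (h : c ∈ labels u ++ (labels l ++ labels r)) : ∃ A B C D : BinaryTree V,
      tripleMatrix (node c A B) C D = tripleMatrix u l r ∧
      (labels (node c A B) ++ (labels C ++ labels D)).Perm
        (labels u ++ (labels l ++ labels r)) := by
  simp only [List.mem_append] at h
  rcases h with h | h | h
  · obtain ⟨A, B, C, D, e, hp⟩ := exists_tripleMatrix_eq_of_mem_middle c u r l h
    refine ⟨A, B, C, D, e.trans (tripleMatrix_rotate _ _ _), hp.trans ?_⟩
    rw [List.perm_iff_count]; intro x
    simp only [List.count_append]; omega
  · exact exists_tripleMatrix_eq_of_mem_middle c l u r h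
  · obtain ⟨A, B, C, D, e, hp⟩ := exists_tripleMatrix_eq_of_mem_middle c r l u h
    refine ⟨A, B, C, D, e.trans (tripleMatrix_rotate _ _ _).symm, hp.trans ?_⟩
    rw [List.perm_iff_count]; intro x
    simp only [List.count_append]; omega

end Trees

/-! ### Generalities on mutation -/

section Mutation

variable {V : Type*}

/-- Multiplication of the rows of a matrix by given factors. -/
def rowScale (d : V → ℤ) (M : Matrix V V ℤ) : Matrix V V ℤ := Matrix.of fun i j => d i * M i j

@[simp] lemma rowScale_apply (d : V → ℤ) (M : Matrix V V ℤ) (i j : V) :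
    rowScale d M i j = d i * M i j := rfl

variable [DecidableEq V]

lemma mutate_apply_of_ne {k i j : V} (hi : i ≠ k) (hj : j ≠ k) (B : Matrix V V ℤ) :
    mutate k B i j = B i j + B i k * max (B k j) 0 + max (-B i k) 0 * B k j := by
  simp [mutate, hi, hj]

lemma mutate_apply_left (k j : V) (B : Matrix V V ℤ) : mutate k B k j = -B k j := by
  simp [mutate]

lemma mutate_apply_right (k i : V) (B : Matrix V V ℤ) : mutate k B i k = -B i k := by
  simp [mutate]

lemma mutate_mutate (k : V) (B : Matrix V V ℤ) : mutate k (mutate k B) = B := by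
  ext i j
  by_cases hi : i = k
  · subst hi; simp [mutate_apply_left]
  by_cases hj : j = k
  · subst hj; simp [mutate_apply_right]
  rw [mutate_apply_of_ne hi hj, mutate_apply_of_ne hi hj, mutate_apply_left, mutate_apply_right]
  have h : ∀ x : ℤ, max (-x) 0 = max x 0 - x := fun x => by
    rcases le_total 0 x with hx | hx <;> simp [hx]
  rw [neg_neg, h, h]; ring

lemma IsSkewSymmetrizable.mutate {B : Matrix V V ℤ} (h : IsSkewSymmetrizable B) (k : V) :
    IsSkewSymmetrizable (mutate k B) := by
  obtain ⟨d, hd, hB⟩ := h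
  refine ⟨d, hd, fun i j => ?_⟩
  by_cases hi : i = k
  · subst hi; rw [mutate_apply_left, mutate_apply_right]; linarith [hB i j]
  by_cases hj : j = k
  · subst hj; rw [mutate_apply_left, mutate_apply_right]; linarith [hB i j]
  rw [mutate_apply_of_ne hi hj, mutate_apply_of_ne hj hi]
  have hmax : ∀ i, d i * max (-B i k) 0 = d k * max (B k i) 0 := fun i => by
    rw [mul_max_of_nonneg _ _ (hd i).le, mul_max_of_nonneg _ _ (hd k).le, mul_neg, hB i k]; simp
  linear_combination hB i j + max (B k j) 0 * hB i k + B k j * hmax i +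
    max (B k i) 0 * hB j k + B k i * hmax j

/-- A property of matrices that is preserved by mutation holds for a matrix if it holds at the end
of a sequence of mutations, because mutations are involutions. -/
lemma MutationEquiv.of_invariant {P : Matrix V V ℤ → Prop} (hP : ∀ k B, P B → P (mutate k B))
    {B B' : Matrix V V ℤ} (h : MutationEquiv B B') (hB' : P B') : P B := by
  induction h using Relation.ReflTransGen.head_induction_on with
  | refl => exact hB'
  | head h _ ih =>
    obtain ⟨k, rfl⟩ := h
    simpa [mutate_mutate] using hP k _ ih

lemma MutationEquiv.isSkewSymmetrizable {B B' : Matrix V V ℤ} (h : MutationEquiv B B')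
    (hB : IsSkewSymmetrizable B) : IsSkewSymmetrizable B' := by
  induction h with
  | refl => exact hB
  | tail _ h ih => obtain ⟨k, rfl⟩ := h; exact ih.mutate k

lemma mutate_rowScale {d : V → ℤ} (hd : ∀ i, 0 ≤ d i) {k : V} (hk : d k = 1)
    (M : Matrix V V ℤ) : mutate k (rowScale d M) = rowScale d (mutate k M) := by
  ext i j
  by_cases hi : i = k
  · subst hi; simp [mutate_apply_left]
  by_cases hj : j = k
  · subst hj; simp [mutate_apply_right]
  simp only [mutate_apply_of_ne hi hj, rowScale_apply, hk, one_mul]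
  have : max (-(d i * M i k)) 0 = d i * max (-M i k) 0 := by
    rw [mul_max_of_nonneg _ _ (hd i)]; simp
  rw [this]; ring

lemma max_sub_eq_of_mul_eq_zero {p q : ℤ} (hp : 0 ≤ p) (hq : 0 ≤ q) (h : p * q = 0) :
    max (p - q) 0 = p := by
  rcases mul_eq_zero.1 h with rfl | rfl <;> simp [hp, hq]

/-- The local form of a mutation at a vertex `k` that lies in the two oriented triangles
`k → x → y → k` and `k → z → w → k` and on no other arrow: they are replaced by the oriented
triangles `k → y → z → k` and `k → w → x → k`. This is the flip of a diagonal of the quadrilateral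
with the sides `x`, `y`, `z`, `w`. -/
lemma mutate_add_triangle_add_triangle {k : V} {x y z w : Option V} {N : Matrix V V ℤ}
    (hl : ∀ j, N k j = 0) (hr : ∀ i, N i k = 0)
    (hx : indicator x k = 0) (hy : indicator y k = 0) (hz : indicator z k = 0)
    (hw : indicator w k = 0)
    (h : ∀ v, (indicator x v + indicator z v) * (indicator y v + indicator w v) = 0) :
    mutate k (N + triangle (some k) x y + triangle (some k) z w) =
      N + triangle (some k) y z + triangle (some k) w x := by
  ext i j
  by_cases hi : i = k
  · subst hi
    simp [mutate_apply_left, triangle_apply, hl, hx, hy, hz, hw]; ring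
  by_cases hj : j = k
  · subst hj
    simp [mutate_apply_right, triangle_apply, hr, hx, hy, hz, hw]; ring
  have hpos : ∀ v, max (indicator x v + indicator z v - (indicator y v + indicator w v)) 0 =
      indicator x v + indicator z v := fun v =>
    max_sub_eq_of_mul_eq_zero (add_nonneg (indicator_nonneg _ _) (indicator_nonneg _ _))
      (add_nonneg (indicator_nonneg _ _) (indicator_nonneg _ _)) (h v)
  have hrow : ∀ v, v ≠ k → (N + triangle (some k) x y + triangle (some k) z w) k v =
      indicator x v + indicator z v - (indicator y v + indicator w v) := fun v hv => by
    simp [triangle_apply, hl, hx, hy, hz, hw, indicator_some_of_ne (Ne.symm hv)]; ring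
  have hcol : ∀ v, v ≠ k → (N + triangle (some k) x y + triangle (some k) z w) v k =
      -(indicator x v + indicator z v - (indicator y v + indicator w v)) := fun v hv => by
    simp [triangle_apply, hr, hx, hy, hz, hw, indicator_some_of_ne (Ne.symm hv)]; ring
  rw [mutate_apply_of_ne hi hj, hrow j hj, hcol i hi, neg_neg, hpos, hpos]
  simp only [Matrix.add_apply, triangle_apply, indicator_some_of_ne (Ne.symm hi),
    indicator_some_of_ne (Ne.symm hj)]
  ring

/-- The local form of a mutation at a vertex `a` whose row is doubled and that lies in the oriented
triangle `a → x → y → a` and on no other arrow: the triangle reverses its orientation. -/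
lemma mutate_rowScale_add_triangle {d : V → ℤ} (hd : ∀ i, 0 ≤ d i) {a : V} (ha : d a = 2)
    {x y : Option V} {N : Matrix V V ℤ}
    (hl : ∀ j, N a j = 0) (hr : ∀ i, N i a = 0)
    (hx : indicator x a = 0) (hy : indicator y a = 0)
    (h : ∀ v, indicator x v * indicator y v = 0) :
    mutate a (rowScale d (N + triangle (some a) x y)) =
      rowScale d (N + triangle (some a) y x) := by
  ext i j
  by_cases hi : i = a
  · subst hi
    simp [mutate_apply_left, triangle_apply, hl, hx, hy]; ring
  by_cases hj : j = a
  · subst hj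
    simp [mutate_apply_right, triangle_apply, hr, hx, hy]; ring
  have hrow : rowScale d (N + triangle (some a) x y) a j =
      2 * indicator x j - 2 * indicator y j := by
    simp [triangle_apply, hl, hx, hy, indicator_some_of_ne (Ne.symm hj), ha]; ring
  have hcol : rowScale d (N + triangle (some a) x y) i a =
      -(d i * indicator x i - d i * indicator y i) := by
    simp [triangle_apply, hr, hx, hy, indicator_some_of_ne (Ne.symm hi)]; ring
  have hi' := indicator_nonneg x i
  have hj' := indicator_nonneg x j
  have hi'' := indicator_nonneg y i
  have hj'' := indicator_nonneg y j
  rw [mutate_apply_of_ne hi hj, hrow, hcol, neg_neg,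
    max_sub_eq_of_mul_eq_zero (by positivity) (by positivity)
      (by linear_combination 4 * h j),
    max_sub_eq_of_mul_eq_zero (mul_nonneg (hd i) hi') (mul_nonneg (hd i) hi'')
      (by linear_combination d i * d i * h i)]
  simp only [rowScale_apply, Matrix.add_apply, triangle_apply, indicator_some_of_ne (Ne.symm hi),
    indicator_some_of_ne (Ne.symm hj)]
  ring

end Mutation

/-! ### Flips of trees -/

section Flips

variable {V : Type*}

/-- The flip of a tree at a vertex `k` other than the root: inside its parent, `k` changes from the
left to the right child or conversely, and the three subtrees of the quadrilateral around `k` keep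
their cyclic order. -/
inductive Flip (k : V) : BinaryTree V → BinaryTree V → Prop
  | toRight (p : V) (A B C : BinaryTree V) :
      Flip k (node p (node k A B) C) (node p A (node k B C))
  | toLeft (p : V) (A B C : BinaryTree V) :
      Flip k (node p A (node k B C)) (node p (node k A B) C)
  | left (p : V) {l l' : BinaryTree V} (r : BinaryTree V) (h : Flip k l l') :
      Flip k (node p l r) (node p l' r)
  | right (p : V) (l : BinaryTree V) {r r' : BinaryTree V} (h : Flip k r r') :
      Flip k (node p l r) (node p l r')

lemma Flip.rootLabel_eq {k : V} {t t' : BinaryTree V} (h : Flip k t t') :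
    rootLabel t' = rootLabel t := by
  cases h <;> rfl

lemma Flip.perm [DecidableEq V] {k : V} {t t' : BinaryTree V} (h : Flip k t t') :
    (labels t').Perm (labels t) := by
  induction h with
  | left p r h ih => exact (ih.append_right _).cons _
  | right p l h ih => exact (ih.append_left _).cons _
  | _ =>
    rw [List.perm_iff_count]; intro x
    simp only [labels_node, List.count_append, List.count_cons]; omega

lemma Flip.mem {k : V} {t t' : BinaryTree V} (h : Flip k t t') : k ∈ labels t := by
  induction h <;> simp_all

lemma Flip.rootLabel_ne {k : V} {t t' : BinaryTree V} (h : Flip k t t') (ht : (labels t).Nodup) :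
    rootLabel t ≠ some k := by
  have hm : ∀ t₁ t₂, Flip k t₁ t₂ → k ∈ labels t₁ := fun _ _ h => h.mem
  cases h with
  | left p r h | right p l h =>
    have := hm _ _ h
    rintro ⟨⟩
    simp_all
  | _ => rintro ⟨⟩; simp_all

lemma exists_flip {k : V} {t : BinaryTree V} (hk : k ∈ labels t) (hr : rootLabel t ≠ some k) :
    ∃ t', Flip k t t' := by
  induction t with
  | nil => simp at hk
  | node p l r hl hr' =>
    simp only [labels_node, List.mem_cons, List.mem_append] at hk
    rcases hk with rfl | hk | hk
    · simp at hr
    · by_cases h : rootLabel l = some k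
      · cases l with
        | nil => simp at h
        | node q A B => obtain rfl : q = k := by simpa using h
                        exact ⟨_, Flip.toRight p A B r⟩
      · obtain ⟨l', h'⟩ := hl hk h
        exact ⟨_, h'.left p r⟩
    · by_cases h : rootLabel r = some k
      · cases r with
        | nil => simp at h
        | node q A B => obtain rfl : q = k := by simpa using h
                        exact ⟨_, Flip.toLeft p l A B⟩
      · obtain ⟨r', h'⟩ := hr' hk h
        exact ⟨_, h'.right p l⟩

/-- The tree in which every vertex of the list is the right child of the preceding one. -/
def rightComb : List V → BinaryTree V
  | [] => nil
  | v :: L => node v nil (rightComb L)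

@[simp] lemma labels_rightComb (L : List V) : labels (rightComb L) = L := by
  induction L with
  | nil => rfl
  | cons v L ih => simp [rightComb, ih]

/-- Two trees related by a flip at some vertex. -/
def FlipStep (t t' : BinaryTree V) : Prop := ∃ k, Flip k t t'

lemma exists_flips_node_nil (p : V) (l : BinaryTree V) : ∀ r : BinaryTree V,
    ∃ r', Relation.ReflTransGen FlipStep (node p l r) (node p nil r') ∧
      r'.numNodes = l.numNodes + r.numNodes := by
  induction l with
  | nil => exact fun r => ⟨r, .refl, by simp⟩
  | node k A B hA _ =>
    intro r
    obtain ⟨r', h, e⟩ := hA (node k B r)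
    refine ⟨r', .head ⟨k, Flip.toRight p A B r⟩ h, ?_⟩
    rw [e]; simp only [numNodes]; omega

lemma exists_flips_rightComb (m : ℕ) : ∀ t : BinaryTree V, t.numNodes = m →
    ∃ L, Relation.ReflTransGen FlipStep t (rightComb L) := by
  induction m with
  | zero =>
    intro t ht
    cases t with
    | nil => exact ⟨[], .refl⟩
    | node v l r => simp at ht
  | succ m ih =>
    intro t ht
    cases t with
    | nil => simp at ht
    | node v l r =>
      obtain ⟨r', h, e⟩ := exists_flips_node_nil v l r
      obtain ⟨L, hL⟩ := ih r' (by simp only [numNodes] at ht; omega)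
      refine ⟨v :: L, h.trans (hL.lift (node v nil) ?_)⟩
      rintro a b ⟨k, hk⟩
      exact ⟨k, hk.right v nil⟩

variable [DecidableEq V]

/-- A flip of trees is the mutation of their matrices. The summand `N` carries the induction: it
collects the contributions of the nodes that are not adjacent to `k`. -/
lemma Flip.mutate_add_treeMatrix {k : V} {t t' : BinaryTree V} (h : Flip k t t')
    (ht : (labels t).Nodup) : ∀ N : Matrix V V ℤ, (∀ j, N k j = 0) → (∀ i, N i k = 0) →
      mutate k (N + treeMatrix t) = N + treeMatrix t' := by
  induction h with
  | toRight p A B C =>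
    intro N hl hr
    have key := mutate_add_triangle_add_triangle (k := k) (x := rootLabel A) (y := rootLabel B)
      (z := rootLabel C) (w := some p)
      (N := N + treeMatrix A + treeMatrix B + treeMatrix C)
    simp only [labels_node, List.nodup_cons, List.nodup_append, List.mem_append, List.mem_cons]
      at ht
    have hkA : k ∉ labels A := by grind
    have hkB : k ∉ labels B := by grind
    have hkC : k ∉ labels C := by grind
    have hpk : p ≠ k := by grind
    specialize key (by simp [hl, treeMatrix_eq_zero_left, hkA, hkB, hkC])
      (by simp [hr, treeMatrix_eq_zero_right, hkA, hkB, hkC])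
      (indicator_rootLabel_eq_zero hkA) (indicator_rootLabel_eq_zero hkB)
      (indicator_rootLabel_eq_zero hkC) (indicator_some_of_ne hpk)
    convert key ?_ using 1
    · congr 1
      simp only [treeMatrix_node, rootLabel_node, triangle]; abel
    · simp only [treeMatrix_node, rootLabel_node, triangle]; abel
    · intro v
      by_cases hv : v ∈ labels A ∨ v ∈ labels C
      · rw [indicator_rootLabel_eq_zero (t := B) (by grind),
          indicator_some_of_ne (v := p) (by grind)]; simp
      · rw [indicator_rootLabel_eq_zero (t := A) (by grind),
          indicator_rootLabel_eq_zero (t := C) (by grind)]; simp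
  | toLeft p A B C =>
    intro N hl hr
    have key := mutate_add_triangle_add_triangle (k := k) (x := rootLabel B) (y := rootLabel C)
      (z := some p) (w := rootLabel A)
      (N := N + treeMatrix A + treeMatrix B + treeMatrix C)
    simp only [labels_node, List.nodup_cons, List.nodup_append, List.mem_append, List.mem_cons]
      at ht
    have hkA : k ∉ labels A := by grind
    have hkB : k ∉ labels B := by grind
    have hkC : k ∉ labels C := by grind
    have hpk : p ≠ k := by grind
    specialize key (by simp [hl, treeMatrix_eq_zero_left, hkA, hkB, hkC])
      (by simp [hr, treeMatrix_eq_zero_right, hkA, hkB, hkC])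
      (indicator_rootLabel_eq_zero hkB) (indicator_rootLabel_eq_zero hkC)
      (indicator_some_of_ne hpk) (indicator_rootLabel_eq_zero hkA)
    convert key ?_ using 1
    · congr 1
      simp only [treeMatrix_node, rootLabel_node, triangle]; abel
    · simp only [treeMatrix_node, rootLabel_node, triangle]; abel
    · intro v
      by_cases hv : v ∈ labels A ∨ v ∈ labels C
      · rw [indicator_rootLabel_eq_zero (t := B) (by grind),
          indicator_some_of_ne (v := p) (by grind)]; simp
      · rw [indicator_rootLabel_eq_zero (t := A) (by grind),
          indicator_rootLabel_eq_zero (t := C) (by grind)]; simp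
  | left p r h ih =>
    rename_i l l'
    intro N hl hr
    have hk := h.mem
    simp only [labels_node, List.nodup_cons, List.nodup_append, List.mem_append] at ht
    have hr' := h.rootLabel_ne ht.2.1
    have hkr : k ∉ labels r := by grind
    have hpk : p ≠ k := by grind
    have h0 : indicator (rootLabel l) k = 0 := if_neg hr'
    have h1 := indicator_some_of_ne hpk
    have h2 := indicator_rootLabel_eq_zero hkr
    have := ih ht.2.1 (N + treeMatrix r + triangle (some p) (rootLabel l) (rootLabel r))
      (by simp [hl, treeMatrix_eq_zero_left hkr, triangle_apply, h0, h1, h2])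
      (by simp [hr, treeMatrix_eq_zero_right hkr, triangle_apply, h0, h1, h2])
    convert this using 1
    · congr 1; rw [treeMatrix_node]; abel
    · rw [treeMatrix_node, h.rootLabel_eq]; abel
  | right p l h ih =>
    rename_i r r'
    intro N hl hr
    have hk := h.mem
    simp only [labels_node, List.nodup_cons, List.nodup_append, List.mem_append] at ht
    have hr' := h.rootLabel_ne ht.2.2.1
    have hkl : k ∉ labels l := by grind
    have hpk : p ≠ k := by grind
    have h0 : indicator (rootLabel r) k = 0 := if_neg hr'
    have h1 := indicator_some_of_ne hpk
    have h2 := indicator_rootLabel_eq_zero hkl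
    have := ih ht.2.2.1 (N + treeMatrix l + triangle (some p) (rootLabel l) (rootLabel r))
      (by simp [hl, treeMatrix_eq_zero_left hkl, triangle_apply, h0, h1, h2])
      (by simp [hr, treeMatrix_eq_zero_right hkl, triangle_apply, h0, h1, h2])
    convert this using 1
    · congr 1; rw [treeMatrix_node]; abel
    · rw [treeMatrix_node, h.rootLabel_eq]; abel

lemma Flip.mutate_treeMatrix {k : V} {t t' : BinaryTree V} (h : Flip k t t')
    (ht : (labels t).Nodup) : mutate k (treeMatrix t) = treeMatrix t' := by
  simpa using h.mutate_add_treeMatrix ht 0 (by simp) (by simp)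

lemma mutationEquiv_rowScale_of_flips {d : V → ℤ} (hd : ∀ i, 0 ≤ d i) {t t' : BinaryTree V}
    (hd' : ∀ i, rootLabel t ≠ some i → d i = 1) (ht : (labels t).Nodup)
    (h : Relation.ReflTransGen FlipStep t t') :
    MutationEquiv (rowScale d (treeMatrix t)) (rowScale d (treeMatrix t')) ∧
      (labels t').Perm (labels t) ∧ rootLabel t' = rootLabel t := by
  induction h with
  | refl => exact ⟨.refl, .refl _, rfl⟩
  | tail _ h ih =>
    obtain ⟨k, hk⟩ := h
    obtain ⟨h1, h2, h3⟩ := ih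
    have hn := h2.nodup_iff.2 ht
    refine ⟨h1.tail ⟨k, ?_⟩, hk.perm.trans h2, hk.rootLabel_eq.trans h3⟩
    rw [mutate_rowScale hd (hd' k (h3 ▸ hk.rootLabel_ne hn)), hk.mutate_treeMatrix hn]

end Flips

/-! ### Paths -/

section Paths

variable {V : Type*}

lemma index_unique {L : List V} (hL : L.Nodup) {i j : ℕ} {w : V} (hi : L[i]? = some w)
    (hj : L[j]? = some w) : i = j := by
  rw [List.getElem?_eq_some_iff] at hi hj
  obtain ⟨hi, e⟩ := hi
  obtain ⟨hj, e'⟩ := hj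
  exact hL.getElem_inj_iff.1 (e.trans e'.symm)

variable [DecidableEq V]

lemma treeMatrix_rightComb_apply : ∀ (L : List V), L.Nodup → ∀ (s u : ℕ) (x y : V),
    L[s]? = some x → L[u]? = some y →
      treeMatrix (rightComb L) x y = if s = u + 1 then 1 else if u = s + 1 then -1 else 0 := by
  intro L
  induction L with
  | nil => simp
  | cons v L ih =>
    intro hL s u x y hx hy
    obtain ⟨hv, hL⟩ := List.nodup_cons.1 hL
    have hroot : ∀ w, indicator (rootLabel (rightComb L)) w = if L[0]? = some w then 1 else 0 := by
      cases L <;> simp [rightComb, indicator]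
    have hvL : ∀ i : ℕ, L[i]? ≠ some v := fun i h => hv (List.mem_of_getElem? h)
    have hne : ∀ (i : ℕ) (w : V), L[i]? = some w → indicator (some v) w = 0 := fun i w hw =>
      indicator_some_of_ne fun h => hvL i (h ▸ hw)
    simp only [rightComb, treeMatrix_node, treeMatrix_nil, zero_add, Matrix.add_apply,
      triangle_apply, rootLabel_nil, indicator_none, hroot]
    rcases s with _ | s <;> rcases u with _ | u
    · simp only [List.getElem?_cons_zero, Option.some.injEq] at hx hy
      subst hx hy
      rw [treeMatrix_eq_zero_left (by simpa using hv)]; simp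
    · simp only [List.getElem?_cons_zero, List.getElem?_cons_succ, Option.some.injEq] at hx hy
      subst hx
      rw [treeMatrix_eq_zero_left (by simpa using hv),
        hne u y hy]
      have : L[0]? = some y ↔ u = 0 := ⟨fun h => index_unique hL hy h, by rintro rfl; exact hy⟩
      simp [hvL, this]
      split_ifs <;> rfl
    · simp only [List.getElem?_cons_zero, List.getElem?_cons_succ, Option.some.injEq] at hx hy
      subst hy
      rw [treeMatrix_eq_zero_right (by simpa using hv),
        hne s x hx]
      have : L[0]? = some x ↔ s = 0 := ⟨fun h => index_unique hL hx h, by rintro rfl; exact hx⟩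
      simp [hvL, this]
    · simp only [List.getElem?_cons_succ] at hx hy
      rw [ih hL s u x y hx hy, hne s x hx,
        hne u y hy]
      simp

/-- A skew-symmetric matrix whose quiver is a path, with any orientation of its arrows, is the
matrix of a tree in which every node has at most one child. -/
lemma exists_treeMatrix_eq_of_path {S : Matrix V V ℤ} (hS : ∀ i j, S i j = -S j i) :
    ∀ (L : List V), L.Nodup → (∀ (s u : ℕ) (x y : V), L[s]? = some x → L[u]? = some y →
      |S x y| = if s = u + 1 ∨ u = s + 1 then 1 else 0) →
    ∃ t, labels t = L ∧ ∀ x ∈ L, ∀ y ∈ L, treeMatrix t x y = S x y := by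
  intro L
  induction L with
  | nil => exact fun _ _ => ⟨nil, by simp⟩
  | cons v L ih =>
    intro hL h
    obtain ⟨hv, hL⟩ := List.nodup_cons.1 hL
    obtain ⟨t, ht, hM⟩ := ih hL fun s u x y hx hy => by
      simpa using h (s + 1) (u + 1) x y (by simpa using hx) (by simpa using hy)
    have hroot : ∀ w, rootLabel t = some w ↔ L[0]? = some w := by
      subst ht; cases t <;> simp
    have habs : ∀ y ∈ L, |S v y| = indicator (rootLabel t) y := by
      intro y hy
      obtain ⟨u, hu⟩ := List.mem_iff_getElem?.1 hy
      rw [h 0 (u + 1) v y (by simp) (by simpa using hu), indicator]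
      have : L[0]? = some y ↔ u = 0 := ⟨fun h => index_unique hL hu h, by rintro rfl; exact hu⟩
      simp [hroot, this]
    have hdiag : ∀ x, S x x = 0 := fun x => by have := hS x x; omega
    obtain ⟨ε, hε, hrow⟩ : ∃ ε : ℤ, (ε = 1 ∨ ε = -1) ∧
        ∀ y ∈ L, S v y = ε * indicator (rootLabel t) y := by
      by_cases hex : ∃ y ∈ L, rootLabel t = some y ∧ S v y < 0
      · obtain ⟨y₀, -, hy₀, hneg⟩ := hex
        refine ⟨-1, Or.inr rfl, fun y hy => ?_⟩
        have h1 := habs y hy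
        by_cases hy' : rootLabel t = some y
        · obtain rfl : y₀ = y := by simpa [hy₀] using hy'
          rw [← h1, abs_of_neg hneg]; ring
        · rw [indicator, if_neg hy'] at h1 ⊢
          simpa using h1
      · push Not at hex
        refine ⟨1, Or.inl rfl, fun y hy => ?_⟩
        have h1 := habs y hy
        by_cases hy' : rootLabel t = some y
        · rw [← h1, abs_of_nonneg (hex y hy hy')]; ring
        · rw [indicator, if_neg hy'] at h1 ⊢
          simpa using h1
    have hvt : v ∉ labels t := ht ▸ hv
    have hne : ∀ y ∈ L, indicator (some v) y = 0 := fun y hy =>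
      indicator_some_of_ne fun h => hv (h ▸ hy)
    have h0 := indicator_rootLabel_eq_zero hvt
    -- the arrow at `v` leaves `v` if its child is a left child, and enters `v` otherwise
    have main : ∀ t' : BinaryTree V, treeMatrix t' =
        treeMatrix t + Matrix.of (fun i j => ε * (indicator (some v) i * indicator (rootLabel t) j -
          indicator (rootLabel t) i * indicator (some v) j)) →
        ∀ x ∈ v :: L, ∀ y ∈ v :: L, treeMatrix t' x y = S x y := by
      intro t' e x hx y hy
      rw [e]
      simp only [Matrix.add_apply, Matrix.of_apply]
      rcases List.mem_cons.1 hx with rfl | hx' <;> rcases List.mem_cons.1 hy with rfl | hy'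
      · simp [treeMatrix_eq_zero_left hvt, hdiag, mul_comm]
      · simp [treeMatrix_eq_zero_left hvt, hrow y hy', h0]
      · simp [treeMatrix_eq_zero_right hvt, hS x y, hrow x hx', h0]
      · simp [hM x hx' y hy', hne x hx', hne y hy']
    rcases hε with rfl | rfl
    · refine ⟨node v t nil, by simp [ht], main _ ?_⟩
      ext i j; simp [treeMatrix_node, triangle_apply]
    · refine ⟨node v nil t, by simp [ht], main _ ?_⟩
      ext i j; simp [treeMatrix_node, triangle_apply]

end Paths

/-! ### Matrices of finite cluster type and trees -/

section ClusterTypes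

variable {V : Type*} [DecidableEq V]

omit [DecidableEq V] in
lemma IsSkewSymmetrizable.sign_skew {B : Matrix V V ℤ} (h : IsSkewSymmetrizable B) (i j : V) :
    (B i j).sign = -(B j i).sign := by
  obtain ⟨d, hd, hB⟩ := h
  have := congrArg Int.sign (hB i j)
  rwa [Int.sign_neg, Int.sign_mul, Int.sign_mul, Int.sign_eq_one_of_pos (hd i),
    Int.sign_eq_one_of_pos (hd j), one_mul, one_mul] at this

omit [DecidableEq V] in
lemma IsSkewSymmetrizable.diag_eq_zero {B : Matrix V V ℤ} (h : IsSkewSymmetrizable B) (i : V) :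
    B i i = 0 := by
  have := h.sign_skew i i
  exact Int.sign_eq_zero_iff_zero.1 (by omega)

/-- The absolute values of the entries of the exchange matrix of a path, the vertices of which are
numbered by `e`, after multiplication of the rows by `d`. -/
def IsScaledPath (d : V → ℤ) {m : ℕ} (e : V ≃ Fin m) (B : Matrix V V ℤ) : Prop :=
  ∀ i j, |B i j| =
    d i * if (e i : ℕ) = e j + 1 ∨ (e j : ℕ) = e i + 1 then 1 else 0

lemma exists_treeMatrix_of_isScaledPath {d : V → ℤ} (hd : ∀ i, 0 < d i) {m : ℕ} {e : V ≃ Fin m}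
    {B : Matrix V V ℤ} (hB : IsSkewSymmetrizable B) (hp : IsScaledPath d e B) :
    ∃ t, (labels t).Nodup ∧ (∀ v, v ∈ labels t) ∧ B = rowScale d (treeMatrix t) ∧
      ∀ v, (e v : ℕ) = 0 → rootLabel t = some v := by
  have hL : ∀ (s : ℕ) (v : V), (List.ofFn e.symm)[s]? = some v → (e v : ℕ) = s := by
    intro s v h
    obtain ⟨hs, h⟩ := List.getElem?_eq_some_iff.1 h
    rw [List.getElem_ofFn] at h
    rw [← h]; simp
  have hmem : ∀ v, v ∈ List.ofFn e.symm := fun v => List.mem_ofFn.2 ⟨e v, by simp⟩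
  have habs : ∀ i j, |(B i j).sign| =
      if (e i : ℕ) = e j + 1 ∨ (e j : ℕ) = e i + 1 then 1 else 0 := by
    intro i j
    have := congrArg Int.sign (hp i j)
    have h : |(B i j).sign| = (|B i j|).sign := by
      rcases lt_trichotomy (B i j) 0 with h | h | h
      · rw [Int.sign_eq_neg_one_of_neg h, abs_of_neg h, Int.sign_eq_one_of_pos (by omega)]; rfl
      · rw [h]; rfl
      · rw [abs_of_pos h, Int.sign_eq_one_of_pos h]; rfl
    rw [h, this, Int.sign_mul, Int.sign_eq_one_of_pos (hd i)]
    split_ifs <;> rfl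
  obtain ⟨t, ht, hM⟩ := exists_treeMatrix_eq_of_path (S := Matrix.of fun i j => (B i j).sign)
    (fun i j => hB.sign_skew i j) (List.ofFn e.symm) (List.nodup_ofFn.2 e.symm.injective) (by
      intro s u x y hx hy
      simp only [Matrix.of_apply]
      rw [habs, hL s x hx, hL u y hy])
  refine ⟨t, ht ▸ List.nodup_ofFn.2 e.symm.injective, ht ▸ hmem, ?_, fun v hv => ?_⟩
  · ext i j
    rw [rowScale_apply, hM i (hmem i) j (hmem j), Matrix.of_apply]
    conv_lhs => rw [← Int.sign_mul_abs (B i j), hp i j, ← habs]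
    rcases Int.sign_trichotomy (B i j) with h | h | h <;> simp [h]
  · have h0 : (labels t)[0]? = some v := by
      obtain ⟨s, hs⟩ := List.mem_iff_getElem?.1 (hmem v)
      obtain rfl : s = 0 := (hL s v hs).symm.trans hv
      rw [ht, hs]
    cases t with
    | nil => simp at h0
    | node w l r => simpa using h0

/-- The matrix of a tree is mutation equivalent to that of a path, by flips that make all nodes
right children. -/
lemma exists_isScaledPath_of_treeMatrix {d : V → ℤ} (hd : ∀ i, 0 ≤ d i) {t : BinaryTree V}
    (hd' : ∀ i, rootLabel t ≠ some i → d i = 1) (ht : (labels t).Nodup)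
    (hfull : ∀ v, v ∈ labels t) :
    ∃ (e : V ≃ Fin (labels t).length) (B : Matrix V V ℤ),
      MutationEquiv (rowScale d (treeMatrix t)) B ∧ IsScaledPath d e B ∧
      ∀ v, rootLabel t = some v → (e v : ℕ) = 0 := by
  obtain ⟨L, hL⟩ := exists_flips_rightComb _ t rfl
  obtain ⟨hmut, hperm, hroot⟩ := mutationEquiv_rowScale_of_flips hd hd' ht hL
  rw [labels_rightComb] at hperm
  have hnodup := hperm.nodup_iff.2 ht
  let e₀ := hnodup.getEquivOfForallMemList L fun v => hperm.mem_iff.2 (hfull v)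
  let e : V ≃ Fin (labels t).length := e₀.symm.trans (finCongr hperm.length_eq)
  have he : ∀ v, L[(e v : ℕ)]? = some v := by
    intro v
    have h1 : (e v : ℕ) = (e₀.symm v : ℕ) := rfl
    have h2 : L.get (e₀.symm v) = v := e₀.apply_symm_apply v
    rw [h1, List.getElem?_eq_some_iff]
    exact ⟨(e₀.symm v).2, h2⟩
  refine ⟨e, _, hmut, fun i j => ?_, fun v hv => ?_⟩
  · rw [rowScale_apply, treeMatrix_rightComb_apply L hnodup _ _ i j (he i) (he j), abs_mul,
      abs_of_nonneg (hd i)]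
    congr 1
    split_ifs <;> first | rfl | omega
  · rw [← hroot] at hv
    cases L with
    | nil => simp [rightComb] at hv
    | cons w L =>
      obtain rfl : w = v := by simpa [rightComb] using hv
      exact index_unique hnodup (he w) (by simp)

lemma abs_apply_of_cartanCounterpart_eq {J : Type*} {C : Matrix J J ℤ} {e : V ≃ J}
    {B : Matrix V V ℤ} (h : cartanCounterpart B = C.submatrix e e) {i j : V} (hij : i ≠ j) :
    |B i j| = -C (e i) (e j) := by
  have := congrFun (congrFun h i) j
  simp only [cartanCounterpart, Matrix.of_apply, if_neg hij, Matrix.submatrix_apply] at this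
  omega

lemma isScaledPath_of_cartanA {m : ℕ} {e : V ≃ Fin m} {B : Matrix V V ℤ}
    (hB : IsSkewSymmetrizable B) (h : cartanCounterpart B = (cartanA m).submatrix e e) :
    IsScaledPath (fun _ => 1) e B := by
  intro i j
  rcases eq_or_ne i j with rfl | hij
  · simp [hB.diag_eq_zero]
  · have hne : (e i : ℕ) ≠ e j := fun h => hij (e.injective (Fin.ext h))
    rw [abs_apply_of_cartanCounterpart_eq h hij, cartanA, CartanMatrix.A, Matrix.of_apply,
      if_neg (fun h => hij (e.injective h))]
    split_ifs <;> first | rfl | omega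

lemma cartanCounterpart_eq_cartanA {m : ℕ} {e : V ≃ Fin m} {B : Matrix V V ℤ}
    (h : IsScaledPath (fun _ => 1) e B) :
    cartanCounterpart B = (cartanA m).submatrix e e := by
  ext i j
  rw [Matrix.submatrix_apply, cartanA, CartanMatrix.A, Matrix.of_apply, cartanCounterpart,
    Matrix.of_apply, h i j]
  rcases eq_or_ne i j with rfl | hij
  · simp
  · rw [if_neg hij, if_neg (fun h => hij (e.injective h))]
    split_ifs <;> first | rfl | omega

/-- The row factors for which the rescaling of a skew-symmetric matrix has a short root at `a` and
long roots of equal length at the other vertices. -/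
def shortAt (a v : V) : ℤ := if v = a then 2 else 1

@[simp] lemma shortAt_self (a : V) : shortAt a a = 2 := if_pos rfl

lemma shortAt_of_ne {a v : V} (h : v ≠ a) : shortAt a v = 1 := if_neg h

lemma shortAt_pos (a v : V) : 0 < shortAt a v := by unfold shortAt; split_ifs <;> norm_num

/-- The Cartan matrix of type `B` has its short root at the last vertex, whereas the trees have it
at the root; so the numbering of the path is reversed. -/
lemma isScaledPath_of_cartanB {m : ℕ} {e : V ≃ Fin m} {B : Matrix V V ℤ} {a : V}
    (ha : (e a : ℕ) + 1 = m) (hB : IsSkewSymmetrizable B)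
    (h : cartanCounterpart B = (cartanB m).submatrix e e) :
    IsScaledPath (shortAt a) (e.trans Fin.revPerm) B := by
  intro i j
  have hi := (e i).2
  have hj := (e j).2
  simp only [Equiv.trans_apply, Fin.revPerm_apply, Fin.val_rev]
  rcases eq_or_ne i j with rfl | hij
  · simp [hB.diag_eq_zero]
  · have hne : (e i : ℕ) ≠ e j := fun h => hij (e.injective (Fin.ext h))
    have ha' : i = a ↔ (e i : ℕ) + 1 = m :=
      ⟨fun h => h ▸ ha, fun h => e.injective (Fin.ext (by omega))⟩
    rw [abs_apply_of_cartanCounterpart_eq h hij, cartanB, CartanMatrix.B, Matrix.transpose_apply,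
      Matrix.of_apply, if_neg (fun h => hij (e.injective h).symm), shortAt]
    simp only [ha']
    split_ifs <;> first | rfl | omega

lemma cartanCounterpart_eq_cartanB {m : ℕ} {e : V ≃ Fin m} {B : Matrix V V ℤ} {a : V}
    (ha : (e a : ℕ) = 0) (h : IsScaledPath (shortAt a) e B) :
    cartanCounterpart B =
      (cartanB m).submatrix (e.trans Fin.revPerm) (e.trans Fin.revPerm) := by
  ext i j
  have hi := (e i).2
  have hj := (e j).2
  rw [Matrix.submatrix_apply, cartanB, CartanMatrix.B, Matrix.transpose_apply, Matrix.of_apply,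
    cartanCounterpart, Matrix.of_apply, h i j]
  rcases eq_or_ne i j with rfl | hij
  · simp
  · have hne : (e i : ℕ) ≠ e j := fun h => hij (e.injective (Fin.ext h))
    have ha' : i = a ↔ (e i : ℕ) = 0 :=
      ⟨fun h => h ▸ ha, fun h => e.injective (Fin.ext (by omega))⟩
    rw [if_neg hij, if_neg (fun h => hij ((e.trans Fin.revPerm).injective h).symm), shortAt]
    simp only [Equiv.trans_apply, Fin.revPerm_apply, Fin.val_rev, ha']
    split_ifs <;> first | rfl | omega

lemma isSkewSymmetrizable_rowScale {d : V → ℤ} {D : V → ℤ} {c : ℤ} (hD : ∀ i, 0 < D i)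
    (hDd : ∀ i, D i * d i = c) (t : BinaryTree V) :
    IsSkewSymmetrizable (rowScale d (treeMatrix t)) := by
  refine ⟨D, hD, fun i j => ?_⟩
  rw [rowScale_apply, rowScale_apply, treeMatrix_skew t i j]
  linear_combination (treeMatrix t j i) * hDd j - treeMatrix t j i * hDd i

omit [DecidableEq V] in
lemma rowScale_one (M : Matrix V V ℤ) : rowScale (fun _ => 1) M = M := by
  ext i j; simp

/-- Every exchange matrix of type `A` arises from three trees joined at their roots. -/
theorem IsOfClusterType.exists_tripleMatrix_eq {m : ℕ} {B : Matrix V V ℤ}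
    (h : IsOfClusterType (cartanA m) B) : ∃ u l r : BinaryTree V,
      (labels u ++ (labels l ++ labels r)).Nodup ∧
      (∀ v, v ∈ labels u ++ (labels l ++ labels r)) ∧ B = tripleMatrix u l r := by
  obtain ⟨hB, B', hBB', e, he⟩ := h
  refine hBB'.of_invariant (P := fun B => ∃ u l r : BinaryTree V,
      (labels u ++ (labels l ++ labels r)).Nodup ∧
      (∀ v, v ∈ labels u ++ (labels l ++ labels r)) ∧ B = tripleMatrix u l r) ?_ ?_
  · rintro k _ ⟨u, l, r, hn, hfull, rfl⟩
    obtain ⟨A, B, C, D, heq, hp⟩ := ClusterDynkin.exists_tripleMatrix_eq (hfull k)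
    rw [← hp.nodup_iff] at hn
    have hp' : (labels (node k B C) ++ (labels D ++ labels A)).Perm
        (labels (node k A B) ++ (labels C ++ labels D)) := by
      rw [List.perm_iff_count]; intro x
      simp only [labels_node, List.count_append, List.count_cons]; omega
    refine ⟨node k B C, D, A, hp'.nodup_iff.2 hn,
      fun v => hp'.mem_iff.2 (hp.mem_iff.2 (hfull v)), ?_⟩
    simp only [labels_node, List.cons_append, List.nodup_cons, List.nodup_append, List.mem_append]
      at hn
    have hA : k ∉ labels A := by grind
    have hB : k ∉ labels B := by grind
    have hC : k ∉ labels C := by grind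
    have hD : k ∉ labels D := by grind
    have key := mutate_add_triangle_add_triangle (k := k) (x := rootLabel A) (y := rootLabel B)
      (z := rootLabel C) (w := rootLabel D)
      (N := treeMatrix A + treeMatrix B + treeMatrix C + treeMatrix D)
      (by simp [treeMatrix_eq_zero_left, hA, hB, hC, hD])
      (by simp [treeMatrix_eq_zero_right, hA, hB, hC, hD])
      (indicator_rootLabel_eq_zero hA) (indicator_rootLabel_eq_zero hB)
      (indicator_rootLabel_eq_zero hC) (indicator_rootLabel_eq_zero hD)
    rw [← heq]
    convert key ?_ using 1
    · congr 1
      simp only [tripleMatrix, treeMatrix_node, rootLabel_node]; abel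
    · simp only [tripleMatrix, treeMatrix_node, rootLabel_node]; abel
    · intro v
      by_cases hv : v ∈ labels A ∨ v ∈ labels C
      · rw [indicator_rootLabel_eq_zero (t := B) (by grind),
          indicator_rootLabel_eq_zero (t := D) (by grind)]; simp
      · rw [indicator_rootLabel_eq_zero (t := A) (by grind),
          indicator_rootLabel_eq_zero (t := C) (by grind)]; simp
  · have hs := hBB'.isSkewSymmetrizable hB
    obtain ⟨t, hn, hfull, e, -⟩ := exists_treeMatrix_of_isScaledPath (fun _ => one_pos) hs
      (isScaledPath_of_cartanA hs he)
    refine ⟨nil, t, nil, by simpa using hn, by simpa using hfull, ?_⟩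
    rw [e, rowScale_one]
    simp [tripleMatrix, triangle, arc_none_left, arc_none_right]

/-- A single tree suffices for the converse: its root stays fixed under the flips that lead to a
path. -/
theorem isOfClusterType_treeMatrix {t : BinaryTree V} (ht : (labels t).Nodup)
    (hfull : ∀ v, v ∈ labels t) :
    IsOfClusterType (cartanA (labels t).length) (treeMatrix t) := by
  obtain ⟨e, B, hmut, hp, -⟩ := exists_isScaledPath_of_treeMatrix (d := fun _ => 1)
    (fun _ => zero_le_one) (fun _ _ => rfl) ht hfull
  rw [rowScale_one] at hmut
  refine ⟨?_, B, hmut, e, cartanCounterpart_eq_cartanA hp⟩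
  have := isSkewSymmetrizable_rowScale (d := fun _ => 1) (D := fun _ => 1) (c := 1)
    (fun _ => one_pos) (fun _ => rfl) t
  rwa [rowScale_one] at this

/-- Every exchange matrix of type `B` arises from a tree whose root is the short root. Mutation at
the root exchanges its two subtrees, and mutation at any other vertex is a flip. -/
theorem IsOfClusterType.exists_treeMatrix_eq {n : ℕ} (hn : 0 < n) {B : Matrix V V ℤ}
    (h : IsOfClusterType (cartanB n) B) : ∃ (a : V) (l r : BinaryTree V),
      (labels (node a l r)).Nodup ∧ (∀ v, v ∈ labels (node a l r)) ∧
      B = rowScale (shortAt a) (treeMatrix (node a l r)) := by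
  obtain ⟨hB, B', hBB', e, he⟩ := h
  refine hBB'.of_invariant (P := fun B => ∃ (a : V) (l r : BinaryTree V),
      (labels (node a l r)).Nodup ∧ (∀ v, v ∈ labels (node a l r)) ∧
      B = rowScale (shortAt a) (treeMatrix (node a l r))) ?_ ?_
  · rintro k _ ⟨a, l, r, hnd, hfull, rfl⟩
    rcases eq_or_ne k a with rfl | hka
    · have hp : (labels (node k r l)).Perm (labels (node k l r)) := by
        rw [List.perm_iff_count]; intro x
        simp only [labels_node, List.count_append, List.count_cons]; omega
      refine ⟨k, r, l, hp.nodup_iff.2 hnd, fun v => hp.mem_iff.2 (hfull v), ?_⟩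
      simp only [labels_node, List.nodup_cons, List.nodup_append, List.mem_append] at hnd
      have hl : k ∉ labels l := by grind
      have hr : k ∉ labels r := by grind
      rw [treeMatrix_node, mutate_rowScale_add_triangle (fun i => (shortAt_pos k i).le)
        (shortAt_self k)
        (by simp [treeMatrix_eq_zero_left, hl, hr]) (by simp [treeMatrix_eq_zero_right, hl, hr])
        (indicator_rootLabel_eq_zero hl) (indicator_rootLabel_eq_zero hr), treeMatrix_node,
        add_comm (treeMatrix l)]
      intro v
      by_cases hv : v ∈ labels l
      · rw [indicator_rootLabel_eq_zero (t := r) (by grind), mul_zero]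
      · rw [indicator_rootLabel_eq_zero hv, zero_mul]
    · obtain ⟨t', ht'⟩ := exists_flip (hfull k) (by simpa using hka.symm)
      rw [mutate_rowScale (fun i => (shortAt_pos a i).le) (shortAt_of_ne hka),
        ht'.mutate_treeMatrix hnd]
      have hp := ht'.perm
      have hroot := ht'.rootLabel_eq
      cases t' with
      | nil => simp at hroot
      | node b l' r' =>
        obtain rfl : b = a := by simpa using hroot
        exact ⟨b, l', r', hp.nodup_iff.2 hnd, fun v => hp.mem_iff.2 (hfull v), rfl⟩
  · have hs := hBB'.isSkewSymmetrizable hB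
    have ha : (e (e.symm ⟨n - 1, by omega⟩) : ℕ) + 1 = n := by simp; omega
    obtain ⟨t, hnd, hfull, e', hroot⟩ := exists_treeMatrix_of_isScaledPath (shortAt_pos _) hs
      (isScaledPath_of_cartanB ha hs he)
    specialize hroot (e.symm ⟨n - 1, by omega⟩) (by simp; omega)
    cases t with
    | nil => simp at hroot
    | node b l r =>
      obtain rfl := Option.some.inj hroot
      exact ⟨_, l, r, hnd, hfull, e'⟩

theorem isOfClusterType_rowScale_treeMatrix {a : V} {l r : BinaryTree V}
    (ht : (labels (node a l r)).Nodup) (hfull : ∀ v, v ∈ labels (node a l r)) :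
    IsOfClusterType (cartanB (labels (node a l r)).length)
      (rowScale (shortAt a) (treeMatrix (node a l r))) := by
  obtain ⟨e, B, hmut, hp, hroot⟩ := exists_isScaledPath_of_treeMatrix (d := shortAt a)
    (fun i => (shortAt_pos a i).le)
    (fun i hi => shortAt_of_ne fun h => hi (by rw [h, rootLabel_node])) ht hfull
  refine ⟨?_, B, hmut, _, cartanCounterpart_eq_cartanB (hroot a rfl) hp⟩
  refine isSkewSymmetrizable_rowScale (D := fun v => if v = a then 1 else 2) (c := 2)
    (fun i => ?_) (fun i => ?_) _
  · split_ifs <;> norm_num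
  · unfold shortAt; split_ifs <;> norm_num

end ClusterTypes

/-! ### Relabelling of trees -/

section Relabelling

variable {V W : Type*}

@[simp] lemma labels_map (f : V → W) (t : BinaryTree V) :
    labels (t.map f) = (labels t).map f := by
  induction t with
  | nil => rfl
  | node v l r hl hr => simp [BinaryTree.map, hl, hr]

@[simp] lemma rootLabel_map (f : V → W) (t : BinaryTree V) :
    rootLabel (t.map f) = (rootLabel t).map f := by
  cases t <;> rfl

lemma exists_map_val_eq {S : Set V} (t : BinaryTree V) (h : ∀ v ∈ labels t, v ∈ S) :
    ∃ t' : BinaryTree S, t'.map Subtype.val = t := by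
  induction t with
  | nil => exact ⟨nil, rfl⟩
  | node v l r hl hr =>
    obtain ⟨l', rfl⟩ := hl fun w hw => h w (by simp [hw])
    obtain ⟨r', rfl⟩ := hr fun w hw => h w (by simp [hw])
    exact ⟨node ⟨v, h v (by simp)⟩ l' r', rfl⟩

variable [DecidableEq V] [DecidableEq W]

lemma indicator_map {f : V → W} (hf : f.Injective) (x : Option V) (v : V) :
    indicator (x.map f) (f v) = indicator x v := by
  cases x <;> simp [indicator, hf.eq_iff]

lemma treeMatrix_map {f : V → W} (hf : f.Injective) (t : BinaryTree V) (i j : V) :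
    treeMatrix (t.map f) (f i) (f j) = treeMatrix t i j := by
  induction t with
  | nil => rfl
  | node v l r hl hr =>
    have h : ∀ i, indicator (some (f v)) (f i) = indicator (some v) i := fun i =>
      indicator_map hf (some v) i
    simp only [BinaryTree.map, treeMatrix_node, Matrix.add_apply, hl, hr, triangle_apply,
      rootLabel_map, indicator_map hf, h]

end Relabelling

/-! ### Diagrams -/

section Diagrams

variable {V : Type*} [DecidableEq V]

lemma indicator_eq_one {x : Option V} {v : V} (h : x = some v) : indicator x v = 1 := if_pos h

lemma treeMatrix_node_root {c : V} {l r : BinaryTree V} (h : (labels (node c l r)).Nodup) (v : V) :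
    treeMatrix (node c l r) c v = indicator (rootLabel l) v - indicator (rootLabel r) v := by
  simp only [labels_node, List.nodup_cons, List.mem_append, not_or] at h
  simp [treeMatrix_node, triangle_apply, treeMatrix_eq_zero_left, h.1,
    indicator_rootLabel_eq_zero]
  ring

lemma treeMatrix_node_left_left {c : V} {l r : BinaryTree V} (h : (labels (node c l r)).Nodup)
    {i : V} (hi : i ∈ labels l) {j : V} (hj : j ∈ labels l) :
    treeMatrix (node c l r) i j = treeMatrix l i j := by
  simp only [labels_node, List.nodup_cons, List.nodup_append, List.mem_append] at h
  have hir : i ∉ labels r := by grind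
  have hjr : j ∉ labels r := by grind
  have hic : c ≠ i := by grind
  have hjc : c ≠ j := by grind
  simp [treeMatrix_node, triangle_apply, treeMatrix_eq_zero_left hir,
    indicator_rootLabel_eq_zero hir, indicator_rootLabel_eq_zero hjr, indicator_some_of_ne hic,
    indicator_some_of_ne hjc]

lemma treeMatrix_node_right_right {c : V} {l r : BinaryTree V} (h : (labels (node c l r)).Nodup)
    {i : V} (hi : i ∈ labels r) {j : V} (hj : j ∈ labels r) :
    treeMatrix (node c l r) i j = treeMatrix r i j := by
  simp only [labels_node, List.nodup_cons, List.nodup_append, List.mem_append] at h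
  have hil : i ∉ labels l := by grind
  have hjl : j ∉ labels l := by grind
  have hic : c ≠ i := by grind
  have hjc : c ≠ j := by grind
  simp [treeMatrix_node, triangle_apply, treeMatrix_eq_zero_left hil,
    indicator_rootLabel_eq_zero hil, indicator_rootLabel_eq_zero hjl, indicator_some_of_ne hic,
    indicator_some_of_ne hjc]

lemma treeMatrix_node_left_right {c : V} {l r : BinaryTree V} (h : (labels (node c l r)).Nodup)
    {i : V} (hi : i ∈ labels l) {j : V} (hj : j ∈ labels r) :
    treeMatrix (node c l r) i j = indicator (rootLabel l) i * indicator (rootLabel r) j := by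
  simp only [labels_node, List.nodup_cons, List.nodup_append, List.mem_append] at h
  have hir : i ∉ labels r := by grind
  have hjl : j ∉ labels l := by grind
  have hic : c ≠ i := by grind
  have hjc : c ≠ j := by grind
  simp [treeMatrix_node, triangle_apply, treeMatrix_eq_zero_left hir,
    treeMatrix_eq_zero_right hjl,
    indicator_rootLabel_eq_zero hir, indicator_rootLabel_eq_zero hjl, indicator_some_of_ne hic,
    indicator_some_of_ne hjc]

lemma treeMatrix_diag (t : BinaryTree V) (i : V) : treeMatrix t i i = 0 := by
  have := treeMatrix_skew t i i
  omega

lemma diagram_mult {B : Matrix V V ℤ} (hB : ∀ i, B i i = 0) (i j : V) :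
    (diagram B).mult i j = (B i j).natAbs * (B j i).natAbs := by
  rcases eq_or_ne i j with rfl | h
  · simp [diagram, diagramOfCartan, hB]
  · simp [diagram, diagramOfCartan, cartanCounterpart, h, h.symm, Int.natAbs_abs]

lemma diagram_arrow {B : Matrix V V ℤ} (hB : ∀ i, B i i = 0) (i j : V) :
    (diagram B).arrow i j ↔ B i j ≠ 0 ∧ |B i j| < |B j i| := by
  rcases eq_or_ne i j with rfl | h
  · simp [diagram, diagramOfCartan, hB]
  · simp [diagram, diagramOfCartan, cartanCounterpart, h, h.symm]

/-- On the labels of the tree `t`, the diagram `X` is the diagram of the matrix of `t`. That matrix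
is skew-symmetric, so there are no inequality signs. -/
def IsTreeDiagram (X : DynkinDiagram V) (t : BinaryTree V) : Prop :=
  ∀ i ∈ labels t, ∀ j ∈ labels t,
    X.mult i j = (treeMatrix t i j).natAbs * (treeMatrix t j i).natAbs ∧ ¬X.arrow i j

lemma adj_root_iff {X : DynkinDiagram V} {c : V} {l r : BinaryTree V}
    (hn : (labels (node c l r)).Nodup) (hX : IsTreeDiagram X (node c l r)) {v : V}
    (hv : v ∈ labels (node c l r)) :
    X.Adj c v ↔ rootLabel l = some v ∨ rootLabel r = some v := by
  rw [DynkinDiagram.Adj, (hX c (by simp) v hv).1, treeMatrix_skew _ v c,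
    treeMatrix_node_root hn, Int.natAbs_neg, mul_self_ne_zero, Int.natAbs_ne_zero]
  have : ¬ (rootLabel l = some v ∧ rootLabel r = some v) := by
    rintro ⟨h₁, h₂⟩
    simp only [labels_node, List.nodup_cons, List.nodup_append] at hn
    exact hn.2.2.2 v (mem_labels_of_rootLabel_eq h₁) v (mem_labels_of_rootLabel_eq h₂) rfl
  unfold indicator
  split_ifs <;> simp_all

lemma isTypeAPieceAt_of_isTreeDiagram {X : DynkinDiagram V} {S : Set V} {c : V}
    {l r : BinaryTree V} (hn : (labels (node c l r)).Nodup)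
    (hS : ∀ v, v ∈ labels (node c l r) ↔ v ∈ S) (hX : IsTreeDiagram X (node c l r)) :
    IsTypeAPieceAt X S c := by
  refine ⟨?_, (hS c).1 (by simp), ?_, ?_⟩
  · obtain ⟨t, ht⟩ := exists_map_val_eq (node c l r) fun v hv => (hS v).1 hv
    refine ⟨(labels t).length, treeMatrix t, isOfClusterType_treeMatrix ?_ ?_, ?_⟩
    · rw [← ht, labels_map] at hn
      exact hn.of_map _
    · rintro ⟨v, hv⟩
      have := (hS v).2 hv
      rw [← ht, labels_map] at this
      simpa [hv] using this
    · have hM : ∀ i j : S, treeMatrix t i j = treeMatrix (node c l r) i j := fun i j => by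
        rw [← ht, treeMatrix_map Subtype.val_injective]
      ext i j
      · rw [diagram_mult (treeMatrix_diag t), hM, hM]
        exact ((hX i ((hS _).2 i.2) j ((hS _).2 j.2)).1).symm
      · rw [diagram_arrow (treeMatrix_diag t), treeMatrix_skew t j i, abs_neg]
        exact iff_of_false (fun h => lt_irrefl _ h.2) (hX i ((hS _).2 i.2) j ((hS _).2 j.2)).2
  · have hsub : {v ∈ S | X.Adj c v} ⊆ {v | rootLabel l = some v} ∪ {v | rootLabel r = some v} :=
      fun v hv => (adj_root_iff hn hX ((hS v).2 hv.1)).1 hv.2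
    have hone : ∀ x : Option V, {v | x = some v}.encard ≤ 1 := fun x =>
      Set.encard_le_one_iff.2 fun a b ha hb => Option.some.inj (ha.symm.trans hb)
    calc _ ≤ _ := Set.encard_le_encard hsub
      _ ≤ _ := Set.encard_union_le _ _
      _ ≤ 1 + 1 := add_le_add (hone _) (hone _)
      _ = 2 := one_add_one_eq_two
  · have hadj : ∀ u v, rootLabel l = some u → rootLabel r = some v → X.Adj u v := by
      intro u v hu hv
      have hu' := mem_labels_of_rootLabel_eq hu
      have hv' := mem_labels_of_rootLabel_eq hv
      rw [DynkinDiagram.Adj, (hX u (by simp [hu']) v (by simp [hv'])).1, treeMatrix_skew _ v u,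
        treeMatrix_node_left_right hn hu' hv', indicator_eq_one hu, indicator_eq_one hv]
      simp
    intro u hu v hv hcu hcv huv
    rcases (adj_root_iff hn hX ((hS u).2 hu)).1 hcu with h | h <;>
      rcases (adj_root_iff hn hX ((hS v).2 hv)).1 hcv with h' | h'
    · exact absurd (Option.some.inj (h.symm.trans h')) huv
    · exact hadj u v h h'
    · rw [DynkinDiagram.Adj, X.mult_symm]
      exact hadj v u h' h
    · exact absurd (Option.some.inj (h.symm.trans h')) huv

lemma tripleMatrix_node_apply {c : V} {A B C D : BinaryTree V}
    (hn : (labels (node c A B) ++ (labels C ++ labels D)).Nodup) (v : V) :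
    tripleMatrix (node c A B) C D c v = indicator (rootLabel A) v - indicator (rootLabel B) v +
      (indicator (rootLabel C) v - indicator (rootLabel D) v) := by
  have h := treeMatrix_node_root (List.nodup_append.1 hn).1 v
  have hC : c ∉ labels C := by simp at hn; tauto
  have hD : c ∉ labels D := by simp at hn; tauto
  simp [tripleMatrix, h, treeMatrix_eq_zero_left hC, treeMatrix_eq_zero_left hD, triangle_apply,
    indicator_rootLabel_eq_zero hC, indicator_rootLabel_eq_zero hD]
  ring

/-- If the quiver of three trees joined at their roots is read from `c`, then a neighbour of `c` on
one side is not adjacent to a neighbour on the other side. Hence one side is empty if all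
neighbours of `c` are adjacent to each other. -/
lemma exists_treeMatrix_eq_tripleMatrix {c : V} {A B C D : BinaryTree V}
    (hn : (labels (node c A B) ++ (labels C ++ labels D)).Nodup)
    (h : ∀ x y, tripleMatrix (node c A B) C D c x ≠ 0 → tripleMatrix (node c A B) C D c y ≠ 0 →
      x ≠ y → tripleMatrix (node c A B) C D x y ≠ 0) :
    ∃ l r, treeMatrix (node c l r) = tripleMatrix (node c A B) C D ∧
      (labels (node c l r)).Perm (labels (node c A B) ++ (labels C ++ labels D)) := by
  have hrow := tripleMatrix_node_apply hn
  by_cases hAB : ∃ x, rootLabel A = some x ∨ rootLabel B = some x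
  · by_cases hCD : ∃ y, rootLabel C = some y ∨ rootLabel D = some y
    · exfalso
      obtain ⟨x, hx⟩ := hAB
      obtain ⟨y, hy⟩ := hCD
      simp only [labels_node, List.cons_append, List.nodup_cons, List.nodup_append,
        List.mem_append] at hn
      have hx' : x ∈ labels A ∨ x ∈ labels B :=
        hx.imp mem_labels_of_rootLabel_eq mem_labels_of_rootLabel_eq
      have hy' : y ∈ labels C ∨ y ∈ labels D :=
        hy.imp mem_labels_of_rootLabel_eq mem_labels_of_rootLabel_eq
      have hxC : x ∉ labels C := by grind
      have hxD : x ∉ labels D := by grind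
      have hyA : y ∉ labels A := by grind
      have hyB : y ∉ labels B := by grind
      have hyc : y ≠ c := by grind
      have hxc : c ≠ x := by grind
      refine h x y ?_ ?_ (by grind) ?_
      · rw [hrow, indicator_rootLabel_eq_zero hxC, indicator_rootLabel_eq_zero hxD]
        rcases hx with hx | hx
        · rw [indicator_eq_one hx, indicator_rootLabel_eq_zero (t := B)
            (by have := mem_labels_of_rootLabel_eq hx; grind)]; norm_num
        · rw [indicator_eq_one hx, indicator_rootLabel_eq_zero (t := A)
            (by have := mem_labels_of_rootLabel_eq hx; grind)]; norm_num
      · rw [hrow, indicator_rootLabel_eq_zero hyA, indicator_rootLabel_eq_zero hyB]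
        rcases hy with hy | hy
        · rw [indicator_eq_one hy, indicator_rootLabel_eq_zero (t := D)
            (by have := mem_labels_of_rootLabel_eq hy; grind)]; norm_num
        · rw [indicator_eq_one hy, indicator_rootLabel_eq_zero (t := C)
            (by have := mem_labels_of_rootLabel_eq hy; grind)]; norm_num
      · simp only [tripleMatrix, Matrix.add_apply]
        rw [treeMatrix_eq_zero_right (t := node c A B) (by simp [hyA, hyB, hyc]),
          treeMatrix_eq_zero_left hxC, treeMatrix_eq_zero_left hxD,
          triangle_eq_zero_left (by exact indicator_some_of_ne hxc)
            (indicator_rootLabel_eq_zero hxC) (indicator_rootLabel_eq_zero hxD)]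
        rfl
    · push Not at hCD
      cases C with
      | node v _ _ => simpa using (hCD v).1
      | nil =>
        cases D with
        | node v _ _ => simpa using (hCD v).2
        | nil => exact ⟨A, B, (tripleMatrix_node_nil_nil c A B).symm, by simp⟩
  · push Not at hAB
    cases A with
    | node v _ _ => simpa using (hAB v).1
    | nil =>
      cases B with
      | node v _ _ => simpa using (hAB v).2
      | nil =>
        refine ⟨C, D, ?_, by simp⟩
        simp [tripleMatrix, treeMatrix_node, triangle, arc_none_left, arc_none_right]

/-- A type `A` piece with attaching vertex `c` is the diagram of a tree with root `c`. -/
lemma IsTypeAPieceAt.exists_tree {X : DynkinDiagram V} {S : Set V} {c : V}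
    (h : IsTypeAPieceAt X S c) : ∃ l r : BinaryTree V, (labels (node c l r)).Nodup ∧
      (∀ v, v ∈ labels (node c l r) ↔ v ∈ S) ∧ IsTreeDiagram X (node c l r) := by
  obtain ⟨⟨m, B, hB, hBX⟩, hc, -, hadj⟩ := h
  obtain ⟨u, l, r, hn, hfull, rfl⟩ := hB.exists_tripleMatrix_eq
  obtain ⟨A, B, C, D, heq, hp⟩ := exists_tripleMatrix_eq (hfull ⟨c, hc⟩)
  rw [← heq] at hBX hB
  have hskew : ∀ i j, tripleMatrix (node ⟨c, hc⟩ A B) C D i j =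
      -tripleMatrix (node ⟨c, hc⟩ A B) C D j i := fun i j => by
    simp only [tripleMatrix, Matrix.add_apply]
    rw [treeMatrix_skew _ i j, treeMatrix_skew C i j, treeMatrix_skew D i j,
      triangle_skew _ _ _ i j]
    ring
  have hdiag := hB.1.diag_eq_zero
  have hXadj : ∀ i j : S, X.Adj i j ↔ tripleMatrix (node ⟨c, hc⟩ A B) C D i j ≠ 0 := by
    intro i j
    have h1 : X.mult i j = (diagram (tripleMatrix (node ⟨c, hc⟩ A B) C D)).mult i j := by
      rw [hBX]; rfl
    rw [DynkinDiagram.Adj, h1, diagram_mult hdiag, hskew j i, Int.natAbs_neg, mul_self_ne_zero,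
      Int.natAbs_ne_zero]
  obtain ⟨l', r', e, hp'⟩ := exists_treeMatrix_eq_tripleMatrix (hp.nodup_iff.2 hn)
    fun x y hx hy hxy => (hXadj x y).1 (hadj x x.2 y y.2 ((hXadj _ _).2 hx) ((hXadj _ _).2 hy)
      fun h => hxy (Subtype.ext h))
  have hmem : ∀ v, v ∈ labels ((node ⟨c, hc⟩ l' r' : BinaryTree S).map Subtype.val) ↔ v ∈ S := by
    intro v
    rw [labels_map, List.mem_map]
    constructor
    · rintro ⟨w, -, rfl⟩; exact w.2
    · exact fun hv => ⟨⟨v, hv⟩, hp'.mem_iff.2 (hp.mem_iff.2 (hfull _)), rfl⟩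
  refine ⟨l'.map Subtype.val, r'.map Subtype.val, ?_, hmem, ?_⟩
  · have := (hp'.nodup_iff.2 (hp.nodup_iff.2 hn)).map Subtype.val_injective
    rwa [← labels_map] at this
  · intro i hi j hj
    obtain ⟨i, rfl⟩ : ∃ i' : S, (i' : V) = i := ⟨⟨i, (hmem i).1 hi⟩, rfl⟩
    obtain ⟨j, rfl⟩ : ∃ j' : S, (j' : V) = j := ⟨⟨j, (hmem j).1 hj⟩, rfl⟩
    have hM : ∀ i j : S, treeMatrix (node c (l'.map Subtype.val) (r'.map Subtype.val)) i j =
        tripleMatrix (node ⟨c, hc⟩ A B) C D i j := fun i j => by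
      rw [← e]; exact treeMatrix_map Subtype.val_injective (node ⟨c, hc⟩ l' r') i j
    have h1 : X.mult i j = (diagram (tripleMatrix (node ⟨c, hc⟩ A B) C D)).mult i j := by
      rw [hBX]; rfl
    have h2 : X.arrow i j ↔ (diagram (tripleMatrix (node ⟨c, hc⟩ A B) C D)).arrow i j := by
      rw [hBX]; rfl
    rw [hM, hM, h1, h2, diagram_mult hdiag, diagram_arrow hdiag, hskew j i, abs_neg]
    simp

/-- The diagram of a tree with root `a` and subtrees `l` and `r`, the row of `a` being doubled,
described in terms of its parts. -/
structure IsShortRootDiagram (X : DynkinDiagram V) (a : V) (l r : BinaryTree V) : Prop where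
  left : IsTreeDiagram X l
  right : IsTreeDiagram X r
  mult_left_right : ∀ i ∈ labels l, ∀ j ∈ labels r,
    (X.mult i j : ℤ) = indicator (rootLabel l) i * indicator (rootLabel r) j
  mult_root : ∀ v, (X.mult v a : ℤ) = 2 * (indicator (rootLabel l) v + indicator (rootLabel r) v)
  arrow_root : ∀ v, X.arrow v a ↔ rootLabel l = some v ∨ rootLabel r = some v

lemma isShortRootDiagram_diagram {a : V} {l r : BinaryTree V}
    (hn : (labels (node a l r)).Nodup) :
    IsShortRootDiagram (diagram (rowScale (shortAt a) (treeMatrix (node a l r)))) a l r := by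
  have hdiag : ∀ i, rowScale (shortAt a) (treeMatrix (node a l r)) i i = 0 := fun i => by
    rw [rowScale_apply, treeMatrix_diag, mul_zero]
  have hn' := hn
  simp only [labels_node, List.nodup_cons, List.nodup_append, List.mem_append, not_or] at hn'
  have hsub : ∀ i j, i ≠ a → j ≠ a →
      (diagram (rowScale (shortAt a) (treeMatrix (node a l r)))).mult i j =
        (treeMatrix (node a l r) i j).natAbs * (treeMatrix (node a l r) j i).natAbs ∧
      ¬(diagram (rowScale (shortAt a) (treeMatrix (node a l r)))).arrow i j := by
    intro i j hi hj
    rw [diagram_mult hdiag, diagram_arrow hdiag, rowScale_apply, rowScale_apply,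
      shortAt_of_ne hi, shortAt_of_ne hj, one_mul, one_mul, treeMatrix_skew _ j i, abs_neg]
    simp
  have hl : ∀ i ∈ labels l, i ≠ a := fun i hi h => hn'.1.1 (h ▸ hi)
  have hr : ∀ i ∈ labels r, i ≠ a := fun i hi h => hn'.1.2 (h ▸ hi)
  have hlr : ∀ i ∈ labels l, i ∉ labels r := fun i hi h => hn'.2.2.2 i hi i h rfl
  have hcase : ∀ v, (rootLabel l = some v ∧ rootLabel r ≠ some v) ∨
      (rootLabel l ≠ some v ∧ rootLabel r = some v) ∨
      (rootLabel l ≠ some v ∧ rootLabel r ≠ some v) := fun v => by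
    have : ¬ (rootLabel l = some v ∧ rootLabel r = some v) := fun h =>
      hlr v (mem_labels_of_rootLabel_eq h.1) (mem_labels_of_rootLabel_eq h.2)
    tauto
  refine ⟨fun i hi j hj => ?_, fun i hi j hj => ?_, fun i hi j hj => ?_, fun v => ?_, fun v => ?_⟩
  · rw [← treeMatrix_node_left_left hn hi hj, ← treeMatrix_node_left_left hn hj hi]
    exact hsub i j (hl i hi) (hl j hj)
  · rw [← treeMatrix_node_right_right hn hi hj, ← treeMatrix_node_right_right hn hj hi]
    exact hsub i j (hr i hi) (hr j hj)
  · rw [(hsub i j (hl i hi) (hr j hj)).1, treeMatrix_skew _ j i,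
      treeMatrix_node_left_right hn hi hj]
    unfold indicator; split_ifs <;> simp
  · rcases eq_or_ne v a with rfl | hv
    · rw [diagram_mult hdiag, hdiag, indicator_rootLabel_eq_zero hn'.1.1,
        indicator_rootLabel_eq_zero hn'.1.2]; simp
    · rw [diagram_mult hdiag, rowScale_apply, rowScale_apply, shortAt_self, shortAt_of_ne hv,
        treeMatrix_skew _ v a, treeMatrix_node_root hn]
      rcases hcase v with ⟨h₁, h₂⟩ | ⟨h₁, h₂⟩ | ⟨h₁, h₂⟩ <;> simp [indicator, h₁, h₂]
  · rcases eq_or_ne v a with rfl | hv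
    · refine iff_of_false (fun h => ?_) ?_
      · exact DynkinDiagram.arrow_asymm _ _ _ h h
      · rintro (h | h)
        · exact hn'.1.1 (mem_labels_of_rootLabel_eq h)
        · exact hn'.1.2 (mem_labels_of_rootLabel_eq h)
    · rw [diagram_arrow hdiag, rowScale_apply, rowScale_apply, shortAt_self, shortAt_of_ne hv,
        treeMatrix_skew _ v a, treeMatrix_node_root hn]
      rcases hcase v with ⟨h₁, h₂⟩ | ⟨h₁, h₂⟩ | ⟨h₁, h₂⟩ <;> simp [indicator, h₁, h₂]

lemma IsShortRootDiagram.unique {X Y : DynkinDiagram V} {a : V} {l r : BinaryTree V}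
    (hfull : ∀ v, v ∈ labels (node a l r)) (hX : IsShortRootDiagram X a l r)
    (hY : IsShortRootDiagram Y a l r) : X = Y := by
  have hroot : ∀ v, X.mult v a = Y.mult v a := fun v => by
    have := hX.mult_root v
    rw [← hY.mult_root v] at this
    exact_mod_cast this
  have hlr : ∀ i ∈ labels l, ∀ j ∈ labels r, X.mult i j = Y.mult i j := fun i hi j hj => by
    have := hX.mult_left_right i hi j hj
    rw [← hY.mult_left_right i hi j hj] at this
    exact_mod_cast this
  have noarrow : ∀ {Z : DynkinDiagram V}, IsShortRootDiagram Z a l r →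
      ∀ i j, j ≠ a → ¬ Z.arrow i j := by
    intro Z hZ i j hj h
    have h2 := Z.two_le_mult_of_arrow _ _ h
    have hle : ∀ i ∈ labels l, ∀ j ∈ labels r, Z.mult i j ≤ 1 := fun i hi j hj => by
      have := hZ.mult_left_right i hi j hj
      unfold indicator at this
      split_ifs at this <;> omega
    have hi := hfull i
    have hj' := hfull j
    simp only [labels_node, List.mem_cons, List.mem_append] at hi hj'
    rcases hi with rfl | hi | hi
    · -- `j` is then joined to the short root by a double edge with the opposite sign
      refine Z.arrow_asymm _ _ h ((hZ.arrow_root j).2 ?_)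
      have := hZ.mult_root j
      rw [Z.mult_symm] at h2
      unfold indicator at this
      by_contra hne
      rw [not_or] at hne
      rw [if_neg hne.1, if_neg hne.2] at this
      omega
    · rcases hj' with hj' | hj' | hj'
      · exact hj hj'
      · exact (hZ.left i hi j hj').2 h
      · have := hle i hi j hj'; omega
    · rcases hj' with hj' | hj' | hj'
      · exact hj hj'
      · have := hle j hj' i hi; rw [Z.mult_symm] at h2; omega
      · exact (hZ.right i hi j hj').2 h
  ext i j
  · have hi := hfull i
    have hj := hfull j
    simp only [labels_node, List.mem_cons, List.mem_append] at hi hj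
    rcases hj with rfl | hj | hj
    · exact hroot i
    · rcases hi with rfl | hi | hi
      · rw [X.mult_symm, Y.mult_symm, hroot]
      · rw [(hX.left i hi j hj).1, (hY.left i hi j hj).1]
      · rw [X.mult_symm, Y.mult_symm, hlr j hj i hi]
    · rcases hi with rfl | hi | hi
      · rw [X.mult_symm, Y.mult_symm, hroot]
      · exact hlr i hi j hj
      · rw [(hX.right i hi j hj).1, (hY.right i hi j hj).1]
  · rcases eq_or_ne j a with rfl | hj
    · rw [hX.arrow_root, hY.arrow_root]
    · exact iff_of_false (noarrow hX i j hj) (noarrow hY i j hj)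

lemma length_labels_eq_card [Fintype V] {t : BinaryTree V} (hn : (labels t).Nodup)
    (hfull : ∀ v, v ∈ labels t) : (labels t).length = Fintype.card V := by
  rw [← List.toFinset_card_of_nodup hn, ← Finset.card_univ]
  congr 1
  ext v
  simp [hfull]

theorem mem_clusterDiagrams_cartanB_iff [Fintype V] (h0 : 0 < Fintype.card V)
    (X : DynkinDiagram V) : X ∈ clusterDiagrams (cartanB (Fintype.card V)) V ↔
      ∃ (a : V) (l r : BinaryTree V), (labels (node a l r)).Nodup ∧
        (∀ v, v ∈ labels (node a l r)) ∧ IsShortRootDiagram X a l r := by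
  constructor
  · rintro ⟨B, hB, rfl⟩
    obtain ⟨a, l, r, hn, hfull, rfl⟩ := hB.exists_treeMatrix_eq h0
    exact ⟨a, l, r, hn, hfull, isShortRootDiagram_diagram hn⟩
  · rintro ⟨a, l, r, hn, hfull, hX⟩
    refine ⟨_, ?_, (isShortRootDiagram_diagram hn).unique hfull hX⟩
    rw [← length_labels_eq_card hn hfull]
    exact isOfClusterType_rowScale_treeMatrix hn hfull

lemma IsShortRootDiagram.doubleEdge {X : DynkinDiagram V} {a : V} {l r : BinaryTree V}
    (hn : (labels (node a l r)).Nodup) (hX : IsShortRootDiagram X a l r) {c : V}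
    (hc : rootLabel l = some c ∨ rootLabel r = some c) : X.DoubleEdge c a := by
  refine ⟨?_, (hX.arrow_root c).2 hc⟩
  have := hX.mult_root c
  simp only [labels_node, List.nodup_cons, List.nodup_append] at hn
  have hlr : ¬ (rootLabel l = some c ∧ rootLabel r = some c) := fun h =>
    hn.2.2.2 c (mem_labels_of_rootLabel_eq h.1) c (mem_labels_of_rootLabel_eq h.2) rfl
  unfold indicator at this
  split_ifs at this <;> first | omega | tauto

lemma IsShortRootDiagram.rootLabel_eq_of_adj {X : DynkinDiagram V} {a : V} {l r : BinaryTree V}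
    (hX : IsShortRootDiagram X a l r) {v : V} (hv : X.Adj v a) :
    rootLabel l = some v ∨ rootLabel r = some v := by
  by_contra h
  rw [not_or] at h
  have := hX.mult_root v
  rw [indicator, if_neg h.1, indicator, if_neg h.2] at this
  exact hv (by omega)

lemma IsShortRootDiagram.shape [Fintype V] (h2 : 2 ≤ Fintype.card V) {X : DynkinDiagram V} {a : V}
    {l r : BinaryTree V} (hn : (labels (node a l r)).Nodup)
    (hfull : ∀ v, v ∈ labels (node a l r)) (hX : IsShortRootDiagram X a l r) :
    HasFirstShape X ∨ HasSecondShape X := by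
  have hn' := hn
  simp only [labels_node, List.nodup_cons, List.mem_append, not_or] at hn'
  obtain ⟨⟨hal, har⟩, hlr⟩ := hn'
  rw [List.nodup_append] at hlr
  obtain ⟨hnl, hnr, hlr⟩ := hlr
  have hmem : ∀ v, v = a ∨ v ∈ labels l ∨ v ∈ labels r := by simpa using hfull
  cases l with
  | nil =>
    cases r with
    | nil =>
      rw [← length_labels_eq_card hn hfull] at h2
      simp at h2
    | node d A B =>
      refine Or.inl ⟨a, d, isTypeAPieceAt_of_isTreeDiagram hnr (fun v => ?_) hX.right,
        hX.doubleEdge hn (Or.inr rfl), fun v hv => ?_⟩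
      · have := hmem v
        rw [Set.mem_compl_singleton_iff]
        constructor
        · rintro h rfl; exact har h
        · intro h; simpa [h] using this
      · simpa [eq_comm] using hX.rootLabel_eq_of_adj hv
  | node c A B =>
    cases r with
    | nil =>
      refine Or.inl ⟨a, c, isTypeAPieceAt_of_isTreeDiagram hnl (fun v => ?_) hX.left,
        hX.doubleEdge hn (Or.inl rfl), fun v hv => ?_⟩
      · have := hmem v
        rw [Set.mem_compl_singleton_iff]
        constructor
        · rintro h rfl; exact hal h
        · intro h; simpa [h] using this
      · simpa [eq_comm] using hX.rootLabel_eq_of_adj hv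
    | node d C D =>
      refine Or.inr ⟨a, c, d, {v | v ∈ labels (node c A B)}, {v | v ∈ labels (node d C D)}, ?_, ?_,
        isTypeAPieceAt_of_isTreeDiagram hnl (fun v => Iff.rfl) hX.left,
        isTypeAPieceAt_of_isTreeDiagram hnr (fun v => Iff.rfl) hX.right,
        hX.doubleEdge hn (Or.inl rfl), hX.doubleEdge hn (Or.inr rfl), ?_, fun v hv => ?_,
        fun u hu v hv huv => ?_⟩
      · ext v
        have := hmem v
        rw [Set.mem_compl_singleton_iff]
        constructor
        · rintro (h | h) rfl
          · exact hal h
          · exact har h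
        · intro h; exact this.resolve_left h
      · exact Set.disjoint_left.2 fun v hv hv' => hlr v hv v hv' rfl
      · have := hX.mult_left_right c (by simp) d (by simp)
        rw [rootLabel_node, rootLabel_node, indicator_self, indicator_self] at this
        rw [DynkinDiagram.SingleEdge]; omega
      · simpa [eq_comm] using hX.rootLabel_eq_of_adj hv
      · have := hX.mult_left_right u hu v hv
        by_contra hne
        rw [not_and_or] at hne
        apply huv
        rcases hne with h | h
        · rw [rootLabel_node, indicator_some_of_ne (Ne.symm h)] at this; omega
        · rw [rootLabel_node, rootLabel_node, indicator_some_of_ne (v := d) (Ne.symm h)] at this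
          omega

lemma HasFirstShape.exists_tree {X : DynkinDiagram V} (h : HasFirstShape X) :
    ∃ (a : V) (l r : BinaryTree V), (labels (node a l r)).Nodup ∧
      (∀ v, v ∈ labels (node a l r)) ∧ IsShortRootDiagram X a l r := by
  obtain ⟨a, c, hpiece, hca, hadj⟩ := h
  obtain ⟨A, B, hn, hS, hX⟩ := hpiece.exists_tree
  have ha : a ∉ labels (node c A B) := fun h => (hS a).1 h rfl
  refine ⟨a, node c A B, nil, ?_, fun v => ?_, hX, by simp [IsTreeDiagram], by simp, fun v => ?_,
    fun v => ?_⟩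
  · rw [labels_node, List.nodup_cons]
    rw [labels_nil, List.append_nil]
    exact ⟨ha, hn⟩
  · rcases eq_or_ne v a with rfl | hv
    · simp
    · rw [labels_node, List.mem_cons, List.mem_append]
      exact Or.inr (Or.inl ((hS v).2 hv))
  · rcases eq_or_ne c v with rfl | hv
    · simp [hca.1]
    · have : X.mult v a = 0 := by
        by_contra h; exact hv (hadj v h).symm
      simp [this, indicator_some_of_ne hv]
  · have hiff : X.arrow v a ↔ c = v := by
      constructor
      · intro h
        have := X.two_le_mult_of_arrow _ _ h
        exact (hadj v (by rw [DynkinDiagram.Adj]; omega)).symm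
      · rintro rfl; exact hca.2
    simp [hiff]

lemma HasSecondShape.exists_tree {X : DynkinDiagram V} (h : HasSecondShape X) :
    ∃ (a : V) (l r : BinaryTree V), (labels (node a l r)).Nodup ∧
      (∀ v, v ∈ labels (node a l r)) ∧ IsShortRootDiagram X a l r := by
  obtain ⟨a, c, d, S, T, hST, hdisj, hpS, hpT, hca, hda, hcd, hadj, hbetween⟩ := h
  obtain ⟨A, B, hnS, hS, hXS⟩ := hpS.exists_tree
  obtain ⟨C, D, hnT, hT, hXT⟩ := hpT.exists_tree
  have hcS : c ∈ S := (hS c).1 (by simp)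
  have hdT : d ∈ T := (hT d).1 (by simp)
  have hne : c ≠ d := fun h => Set.disjoint_left.1 hdisj hcS (h ▸ hdT)
  have haS : a ∉ S := fun h => (hST ▸ Or.inl h : a ∈ ({a}ᶜ : Set V)) rfl
  have haT : a ∉ T := fun h => (hST ▸ Or.inr h : a ∈ ({a}ᶜ : Set V)) rfl
  refine ⟨a, node c A B, node d C D, ?_, fun v => ?_, hXS, hXT, fun i hi j hj => ?_, fun v => ?_,
    fun v => ?_⟩
  · rw [labels_node, List.nodup_cons, List.mem_append, List.nodup_append, hS, hT]
    refine ⟨by tauto, hnS, hnT, ?_⟩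
    rintro i hi j hj rfl
    exact Set.disjoint_left.1 hdisj ((hS i).1 hi) ((hT i).1 hj)
  · rw [labels_node, List.mem_cons, List.mem_append, hS, hT]
    rcases eq_or_ne v a with rfl | hv
    · exact Or.inl rfl
    · exact Or.inr (hST.symm ▸ hv : v ∈ S ∪ T)
  · rw [rootLabel_node, rootLabel_node]
    by_cases h : i = c ∧ j = d
    · obtain ⟨rfl, rfl⟩ := h
      rw [DynkinDiagram.SingleEdge] at hcd
      simp [hcd]
    · have h0 : X.mult i j = 0 := by
        by_contra h'; exact h (hbetween i ((hS i).1 hi) j ((hT j).1 hj) h')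
      rw [h0]
      rcases not_and_or.1 h with h | h
      · rw [indicator_some_of_ne (Ne.symm h)]; simp
      · rw [indicator_some_of_ne (v := d) (Ne.symm h)]; simp
  · rw [rootLabel_node, rootLabel_node]
    by_cases hvc : c = v
    · subst hvc; simp [hca.1, indicator_some_of_ne hne.symm]
    by_cases hvd : d = v
    · subst hvd; simp [hda.1, indicator_some_of_ne hne]
    have : X.mult v a = 0 := by
      by_contra h
      rcases hadj v h with h | h
      · exact hvc h.symm
      · exact hvd h.symm
    simp [this, indicator_some_of_ne hvc, indicator_some_of_ne hvd]
  · rw [rootLabel_node, rootLabel_node, Option.some_inj, Option.some_inj]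
    constructor
    · intro h
      have := X.two_le_mult_of_arrow _ _ h
      exact (hadj v (by rw [DynkinDiagram.Adj]; omega)).imp Eq.symm Eq.symm
    · rintro (rfl | rfl)
      · exact hca.2
      · exact hda.2

end Diagrams

end ClusterDynkin

theorem mainTheorem7 (n : ℕ) (hn : 2 ≤ n) {V : Type*} [Fintype V] [DecidableEq V]
    (hV : Fintype.card V = n) (X : ClusterDynkin.DynkinDiagram V) :
    X ∈ ClusterDynkin.clusterDiagrams (ClusterDynkin.cartanB n) V ↔
      (ClusterDynkin.HasFirstShape X ∨ ClusterDynkin.HasSecondShape X) := by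
  subst hV
  rw [ClusterDynkin.mem_clusterDiagrams_cartanB_iff (by omega)]
  constructor
  · rintro ⟨a, l, r, hnodup, hfull, hX⟩
    exact hX.shape hn hnodup hfull
  · rintro (h | h)
    · exact h.exists_tree
    · exact h.exists_tree
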